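/- **Setting.** Let $\rho$ be a state (density matrix) on $\mathbb C^d$. A source emits $d$-dimensional systems one after the other; the first $\nu\ge 0$ are in the state $\rho$ and all later ones in a post-change state $\sigma$ (for "$\nu=\infty$" all are in the state $\rho$). $D(\sigma\|\rho)=\mathrm{tr}[\sigma(\log\sigma-\log\rho)]$ if $\mathrm{supp}\,\sigma\subseteq\mathrm{supp}\,\rho$ and $+\infty$ otherwise; $\log$ is natural. For a block length $l$, a *Hayashi measurement* for $\rho$ is a rank-one projective measurement $M^{(l)}=\{M_x\}$ on $(\mathbb C^d)^{\otimes l}$ in an orthonormal basis of eigenvectors of $\rho^{\otimes l}$ which refines an orthogonal decomposition of $(\mathbb C^d)^{\otimes l}$ into irreducible subspaces of the tensor representation $A\mapsto A^{\otimes l}$. It depends on $\rho$ only. Let $S$ be a finite non-empty set of states $\sigma$ with $\mathrm{supp}\,\sigma\subseteq\mathrm{supp}\,\rho$. The *generalized-likelihood QUSUM* test with threshold $h\in\mathbb R$ measures consecutive blocks of $l$ systems with $M^{(l)}$, obtaining outcomes $x_1,x_2,\dots$. For $\sigma\in S$ put $Z_i(\sigma)=\log\big(\mathrm{tr}[M_{x_i}\sigma^{\otimes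 l}]/\mathrm{tr}[M_{x_i}\rho^{\otimes l}]\big)$, $T_j=\min\{n\ge j:\max_{\sigma\in S}\sum_{i=j}^n Z_i(\sigma)\ge h\}$ (with $\min\emptyset=\infty$), and $T^*=\min_{j\ge1}T_j$. The alarm time, counted in systems, is $T=lT^*$. Let $\bar T_{\rm FA}=\mathbb E_\infty[T]$ be the mean false alarm time and $$\bar\tau^\star(\sigma)=\sup_{\nu\ge0}\ \sup_{x^\nu:\,P_\infty(X^\nu=x^\nu)>0}\mathbb E_\nu[T-\nu\mid T>\nu,\ X^\nu=x^\nu]$$ the worst-case mean delay for the post-change state $\sigma$, where $X^\nu$ is the record of the outcomes of all blocks completed within the first $\nu$ systems (records incompatible with $T>\nu$ are ignored). The change point $\nu$ need not be a multiple of $l$; a block containing the change is in the state $\rho^{\otimes a}\otimes\sigma^{\otimes(l-a)}$. For a set $S'$ of states put $\bar\tau^\star(S')=\sup_{\sigma'\in S'}\bar\tau^\star(\sigma')$. We say that the test *achieves the rate $I$ on $S'$* if both of the following hold. * For every $\varepsilon>0$, for all sufficiently large $l$ and then all $h$ sufficiently large (depending on $l$), $$\bar\tau^\star(S')\le\frac{h(1+\varepsilon)}{I}\quad\text{and}\quad\bar\tau^\star(S')\le\frac{\log\bar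 T_{\rm FA}\,(1+\varepsilon)}{I}.$$ * There are block lengths $L(\gamma)$ such that, as $\gamma\to\infty$, the test with block length $L(\gamma)$ and threshold $h=\log\gamma+\log|S|$ has $\bar T_{\rm FA}\ge\gamma$ and $\bar\tau^\star(S')\le\log\gamma\,(1+o(1))/I$. **Theorem.** A Hayashi measurement for $\rho$ exists for every $l$. For every choice of Hayashi measurements $M^{(l)}$, $l\ge 0$, and every finite non-empty set $S$ of states with $\mathrm{supp}\,\sigma\subseteq\mathrm{supp}\,\rho$ for all $\sigma\in S$: 1. (False alarms) $\bar T_{\rm FA}\ge l\,e^{h}/|S|$ for all $l$ and $h$. 2. (Arbitrary change points) $\bar\tau^\star(\sigma)\le l\,(1+\mathbb E_0[T_1])$ for all $l$, $h$ and every post-change state $\sigma$, where $\mathbb E_0$ refers to the sequence in which all systems are in the state $\sigma$. 3. (Finite family) If $\min_{\sigma\in S}D(\sigma\|\rho)>0$, the test achieves on $S$ the rate $\min_{\sigma\in S}D(\sigma\|\rho)$. 4. (General family with a finite discretization) Let $S'$ be any set of states with $\mathrm{supp}\,\sigma'\subseteq\mathrm{supp}\,\rho$ for all $\sigma'\in S'$,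 and suppose that $$I=\inf_{\sigma'\in S'}\max_{\sigma\in S}\big(D(\sigma'\|\rho)-D(\sigma'\|\sigma)\big)>0 .$$ Then the test with the family $S$ achieves on $S'$ the rate $I$. -/

import Mathlib

open Filter Topology MeasureTheory ProbabilityTheory
open scoped ENNReal ComplexOrder Matrix

noncomputable section

/-! ### States, relative entropy, tensor products -/

/-- A state (density matrix) of a `d`-dimensional quantum system. -/
structure QState (d : ℕ) where
  mat : Matrix (Fin d) (Fin d) ℂ
  posSemidef : mat.PosSemidef
  trace_eq_one : mat.trace = 1

/-- `supp σ ⊆ supp ρ`, i.e. `ker ρ ⊆ ker σ`. -/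
def SuppLE {d : ℕ} (σ ρ : QState d) : Prop :=
  ∀ v : Fin d → ℂ, ρ.mat *ᵥ v = 0 → σ.mat *ᵥ v = 0

open Classical in
/-- Quantum relative entropy `D(σ‖ρ) = tr[σ (log σ - log ρ)]` (natural logarithm), equal to `+∞`
unless `supp σ ⊆ supp ρ`. The functional calculus uses `log 0 = 0`, that is, the logarithms are
taken on the supports, which is the usual convention `0 log 0 = 0`. -/
def relEntropy {d : ℕ} (σ ρ : QState d) : EReal :=
  if SuppLE σ ρ then
    (((σ.mat * (cfc Real.log σ.mat - cfc Real.log ρ.mat)).trace.re : ℝ) : EReal)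
  else ⊤

/-- The tensor product `A₁ ⊗ ⋯ ⊗ A_l` as a matrix on `(ℂ^d)^{⊗ l}`, whose standard basis is
indexed by `Fin l → Fin d`. -/
def tensorProd {d l : ℕ} (A : Fin l → Matrix (Fin d) (Fin d) ℂ) :
    Matrix (Fin l → Fin d) (Fin l → Fin d) ℂ :=
  Matrix.of fun i j => ∏ t, A t (i t) (j t)

/-- The tensor power `A^{⊗ l}`. -/
def tensorPow {d : ℕ} (A : Matrix (Fin d) (Fin d) ℂ) (l : ℕ) :
    Matrix (Fin l → Fin d) (Fin l → Fin d) ℂ :=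
  tensorProd fun _ => A

/-- The Hilbert space `(ℂ^d)^{⊗ l}` of a block of `l` systems. -/
abbrev BlockSpace (d l : ℕ) : Type := EuclideanSpace ℂ (Fin l → Fin d)

/-! ### Block measurements -/

/-- A complete (rank-one) projective measurement on a block, given by an orthonormal basis: the
outcomes are `x : Fin (d ^ l)`, and outcome `x` has the projector onto the `x`-th vector. -/
abbrev BlockPVM (d l : ℕ) : Type := OrthonormalBasis (Fin (d ^ l)) ℂ (BlockSpace d l)

/-- The projector `M_x = |b_x⟩⟨b_x|` of outcome `x`. -/
def effect {d l : ℕ} (b : BlockPVM d l) (x : Fin (d ^ l)) :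
    Matrix (Fin l → Fin d) (Fin l → Fin d) ℂ :=
  Matrix.vecMulVec (b x).ofLp (star (b x).ofLp)

/-- `W` is invariant under the tensor representation `A ↦ A^{⊗ l}`. (Since invertible matrices are
dense, and by the unitary trick, letting `A` range over all matrices, over `GL(d)`, over `SL(d)`
or over `SU(d)` gives the same invariant subspaces.) -/
def TensorInvariant {d l : ℕ} (W : Submodule ℂ (BlockSpace d l)) : Prop :=
  ∀ A : Matrix (Fin d) (Fin d) ℂ, ∀ w ∈ W, Matrix.toEuclideanLin (tensorPow A l) w ∈ W

/-- `W` is an irreducible subspace of the tensor representation. -/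
def TensorIrreducible {d l : ℕ} (W : Submodule ℂ (BlockSpace d l)) : Prop :=
  TensorInvariant W ∧ W ≠ ⊥ ∧ ∀ V ≤ W, TensorInvariant V → V = ⊥ ∨ V = W

/-- Hayashi's block measurement for the state `ρ`: a rank-one projective measurement on
`(ℂ^d)^{⊗ l}` that commutes with `ρ^{⊗ l}` (its vectors are eigenvectors of `ρ^{⊗ l}`) and refines
an orthogonal decomposition of `(ℂ^d)^{⊗ l}` into irreducible subspaces of the tensor
representation (`c x` is the label of the irreducible subspace that contains the `x`-th vector).
It depends on `ρ` only. -/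
structure IsHayashiPVM {d l : ℕ} (ρ : QState d) (b : BlockPVM d l) : Prop where
  eigenvector : ∀ x, ∃ r : ℂ, Matrix.toEuclideanLin (tensorPow ρ.mat l) (b x) = r • b x
  irreducible : ∃ c : Fin (d ^ l) → ℕ,
    ∀ x, TensorIrreducible (Submodule.span ℂ (b '' {y | c y = c x}))

/-! ### Outcome distributions -/

theorem tensorProd_mul {d l : ℕ} (A B : Fin l → Matrix (Fin d) (Fin d) ℂ) :
    tensorProd A * tensorProd B = tensorProd fun t => A t * B t := by
  ext i j
  simp only [tensorProd, Matrix.mul_apply, Matrix.of_apply]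
  rw [Finset.prod_univ_sum, Fintype.piFinset_univ]
  exact Finset.sum_congr rfl fun k _ => Finset.prod_mul_distrib.symm

theorem tensorProd_conjTranspose {d l : ℕ} (A : Fin l → Matrix (Fin d) (Fin d) ℂ) :
    (tensorProd A)ᴴ = tensorProd fun t => (A t)ᴴ := by
  ext i j
  simp [tensorProd, Matrix.conjTranspose_apply]

theorem tensorProd_posSemidef {d l : ℕ} (s : Fin l → QState d) :
    (tensorProd fun t => (s t).mat).PosSemidef := by
  have h : ∀ t, ∃ B : Matrix (Fin d) (Fin d) ℂ, (s t).mat = Bᴴ * B := fun t => by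
    classical
    open scoped MatrixOrder in
    obtain ⟨B, hB⟩ := CStarAlgebra.nonneg_iff_eq_star_mul_self.mp (s t).posSemidef.nonneg
    exact ⟨B, hB⟩
  choose B hB using h
  have : (tensorProd fun t => (s t).mat) = (tensorProd B)ᴴ * tensorProd B := by
    rw [tensorProd_conjTranspose, tensorProd_mul]
    congr 1
    exact funext hB
  rw [this]
  exact Matrix.posSemidef_conjTranspose_mul_self _

theorem tensorProd_trace {d l : ℕ} (s : Fin l → QState d) :
    (tensorProd fun t => (s t).mat).trace = 1 := by
  simp only [tensorProd, Matrix.trace, Matrix.diag_apply, Matrix.of_apply]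
  have h := Finset.prod_univ_sum (fun _ : Fin l => (Finset.univ : Finset (Fin d)))
    (fun t i => (s t).mat i i)
  rw [Fintype.piFinset_univ] at h
  rw [← h]
  exact Finset.prod_eq_one fun t _ => (s t).trace_eq_one

/-- Born rule: the probability `tr[M_x (s₁ ⊗ ⋯ ⊗ s_l)]` of outcome `x` when the systems in the
block are in the states `s₁, …, s_l`. -/
def born {d l : ℕ} (b : BlockPVM d l) (s : Fin l → QState d) (x : Fin (d ^ l)) : ℝ :=
  (effect b x * tensorProd fun t => (s t).mat).trace.re

theorem effect_mul_trace {d l : ℕ} (b : BlockPVM d l)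
    (τ : Matrix (Fin l → Fin d) (Fin l → Fin d) ℂ) (x : Fin (d ^ l)) :
    (effect b x * τ).trace = star (b x).ofLp ⬝ᵥ (τ *ᵥ (b x).ofLp) := by
  rw [effect, Matrix.trace_mul_comm, Matrix.mul_vecMulVec, Matrix.trace_vecMulVec,
    dotProduct_comm]

theorem born_nonneg {d l : ℕ} (b : BlockPVM d l) (s : Fin l → QState d) (x : Fin (d ^ l)) :
    0 ≤ born b s x := by
  rw [born, effect_mul_trace]
  exact (Complex.le_def.mp ((tensorProd_posSemidef s).dotProduct_mulVec_nonneg _)).1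

theorem born_sum {d l : ℕ} (b : BlockPVM d l) (s : Fin l → QState d) :
    ∑ x, born b s x = 1 := by
  have h := LinearMap.trace_eq_sum_inner
    (Matrix.toEuclideanLin (tensorProd fun t => (s t).mat)) b
  have h2 : LinearMap.trace ℂ _ (Matrix.toEuclideanLin (tensorProd fun t => (s t).mat)) = 1 := by
    rw [Matrix.toEuclideanLin_eq_toLin_orthonormal, Matrix.trace_toLin_eq, tensorProd_trace]
  rw [h2] at h
  have h3 : ∀ x, born b s x =
      (inner ℂ (b x) (Matrix.toEuclideanLin (tensorProd fun t => (s t).mat) (b x))).re := by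
    intro x
    rw [born, effect_mul_trace, EuclideanSpace.inner_eq_star_dotProduct, dotProduct_comm]
    rfl
  rw [Finset.sum_congr rfl fun x _ => h3 x, ← Complex.re_sum, ← h, Complex.one_re]

/-- The distribution of the outcome of the measurement `b` on a block in states `s₁, …, s_l`. -/
def blockPMF {d l : ℕ} (b : BlockPVM d l) (s : Fin l → QState d) : PMF (Fin (d ^ l)) :=
  PMF.ofFintype (fun x => ENNReal.ofReal (born b s x)) (by
    rw [← ENNReal.ofReal_sum_of_nonneg fun x _ => born_nonneg b s x, born_sum,
      ENNReal.ofReal_one])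

/-- The change point sequence: the first `ν` systems are in the state `ρ`, all later ones in the
state `σ`. (Systems are indexed from `0`, so index `n` is the `(n+1)`-st system.) -/
def changePoint {d : ℕ} (ρ σ : QState d) (ν n : ℕ) : QState d := if n < ν then ρ else σ

/-- The law of the sequence of block outcomes when consecutive blocks of `l` systems of the
sequence `s` are measured with `b`: the `k`-th block (from `0`) consists of the systems
`k * l, …, k * l + l - 1`. A block in which the change occurs is in a mixed product state
`ρ ⊗ ⋯ ⊗ ρ ⊗ σ ⊗ ⋯ ⊗ σ`. -/
def pathLaw {d l : ℕ} (b : BlockPVM d l) (s : ℕ → QState d) : Measure (ℕ → Fin (d ^ l)) :=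
  Measure.infinitePi fun k => (blockPMF b fun t : Fin l => s (k * l + t)).toMeasure

/-! ### The QUSUM test for an unknown post-change state -/

/-- Log-likelihood ratio `Z(σ) = log (q(x) / p(x)) ∈ [-∞, ∞]` of a block outcome, where `q` and `p`
are the outcome distributions for `σ^{⊗ l}` and `ρ^{⊗ l}`. -/
def logLR {d l : ℕ} (b : BlockPVM d l) (ρ σ : QState d) (x : Fin (d ^ l)) : EReal :=
  ENNReal.log (blockPMF b (fun _ => σ) x / blockPMF b (fun _ => ρ) x)

/-- The generalized log-likelihood ratio `max_{σ ∈ S} ∑_i Z_i(σ)` of the blocks with (zero-based)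
indices `j, …, n - 1`. -/
def glr {d l : ℕ} (b : BlockPVM d l) (ρ : QState d) (S : Finset (QState d))
    (ω : ℕ → Fin (d ^ l)) (j n : ℕ) : EReal :=
  ⨆ σ ∈ S, ∑ i ∈ Finset.Ico j n, logLR b ρ σ (ω i)

/-- The number of blocks after which the test that ignores the first `j` blocks stops: the first
`n > j` at which the generalized log-likelihood ratio reaches the threshold `h` (`⊤` if never). -/
def stopFrom {d l : ℕ} (b : BlockPVM d l) (ρ : QState d) (S : Finset (QState d)) (h : ℝ)
    (j : ℕ) (ω : ℕ → Fin (d ^ l)) : ℕ∞ :=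
  ⨅ (n : ℕ) (_ : j < n ∧ (h : EReal) ≤ glr b ρ S ω j n), (n : ℕ∞)

/-- The number of blocks after which QUSUM stops: the minimum of all `stopFrom j`. -/
def qusum {d l : ℕ} (b : BlockPVM d l) (ρ : QState d) (S : Finset (QState d)) (h : ℝ)
    (ω : ℕ → Fin (d ^ l)) : ℕ∞ :=
  ⨅ j, stopFrom b ρ S h j ω

/-- The alarm time `T` of QUSUM, in number of systems received. -/
def alarmTime {d l : ℕ} (b : BlockPVM d l) (ρ : QState d) (S : Finset (QState d)) (h : ℝ)
    (ω : ℕ → Fin (d ^ l)) : ℕ∞ :=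
  (l : ℕ∞) * qusum b ρ S h ω

/-- The mean false alarm time `E_∞[T]`. -/
def meanFalseAlarm {d l : ℕ} (b : BlockPVM d l) (ρ : QState d) (S : Finset (QState d)) (h : ℝ) :
    ℝ≥0∞ :=
  ∫⁻ ω, (alarmTime b ρ S h ω : ℝ≥0∞) ∂pathLaw b (fun _ => ρ)

/-- The event that the record available after `ν` systems, that is the outcomes of the `⌊ν / l⌋`
blocks completed by then, is the one given by `y`. -/
def record {d : ℕ} (l ν : ℕ) (y : ℕ → Fin (d ^ l)) : Set (ℕ → Fin (d ^ l)) :=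
  {ω | ∀ k < ν / l, ω k = y k}

/-- The worst-worst case mean delay for the post-change state `σ`: the supremum of
`E_ν[T - ν | T > ν, X^ν = x^ν]` over all change points `ν` (not only multiples of `l`) and all
records `x^ν` that have positive probability without change. (Conditioning on an event of
probability zero contributes `0`.) -/
def worstDelay {d l : ℕ} (b : BlockPVM d l) (ρ : QState d) (S : Finset (QState d)) (h : ℝ)
    (σ : QState d) : ℝ≥0∞ :=
  ⨆ (ν : ℕ) (y : ℕ → Fin (d ^ l)) (_ : pathLaw b (fun _ => ρ) (record l ν y) ≠ 0),
    ∫⁻ ω, ((alarmTime b ρ S h ω - ν : ℕ∞) : ℝ≥0∞)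
      ∂(pathLaw b (changePoint ρ σ ν))[|{ω | (ν : ℕ∞) < alarmTime b ρ S h ω} ∩ record l ν y]

/-- The worst case of `worstDelay` over a family `S'` of post-change states. -/
def familyDelay {d l : ℕ} (b : BlockPVM d l) (ρ : QState d) (S : Finset (QState d)) (h : ℝ)
    (S' : Set (QState d)) : EReal :=
  ((⨆ σ ∈ S', worstDelay b ρ S h σ : ℝ≥0∞) : EReal)

/-- QUSUM with the measurements `M` and the finite family `S` detects changes into the family `S'`
at the rate `I`: the mean delay is at most `log T_FA (1 + o(1)) / I`. The first clause is for large
blocks and large thresholds `h`. In the second one the test is tuned to guarantee a mean false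
alarm time of at least `γ → ∞`, with threshold `log γ + log |S|` and a block length `L γ`. -/
def AchievesRate {d : ℕ} (M : ∀ l, BlockPVM d l) (ρ : QState d) (S : Finset (QState d))
    (S' : Set (QState d)) (I : EReal) : Prop :=
  (∀ ε : ℝ, 0 < ε → ∀ᶠ l : ℕ in atTop, ∀ᶠ h : ℝ in atTop,
    familyDelay (M l) ρ S h S' ≤ ((h * (1 + ε) : ℝ) : EReal) / I ∧
    familyDelay (M l) ρ S h S' ≤
      ENNReal.log (meanFalseAlarm (M l) ρ S h) * ((1 + ε : ℝ) : EReal) / I) ∧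
  ∃ (L : ℝ → ℕ) (δ : ℝ → ℝ), Tendsto δ atTop (𝓝 0) ∧ ∀ᶠ γ : ℝ in atTop,
    ENNReal.ofReal γ ≤ meanFalseAlarm (M (L γ)) ρ S (Real.log γ + Real.log S.card) ∧
    familyDelay (M (L γ)) ρ S (Real.log γ + Real.log S.card) S' ≤
      ((Real.log γ * (1 + δ γ) : ℝ) : EReal) / I

end

/-! False alarms are controlled by the Shiryaev–Roberts statistic. For each `σ` it is the sum, over
all starting blocks, of the likelihood ratio products, so it dominates each of them. Without change,
one step raises its conditional mean by at most `1`. Summed over `S` it has reached `exp h` at the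
alarm, whence `exp h ≤ |S| E[T*]`.

For the delay, restart the test at the first block after the one in progress at the change. That
block costs at most `l` systems. The later blocks are all in the post-change state and independent
of the record, and QUSUM stops no later than the restarted test. This gives `l (1 + E_0[T_1])`.
Wald's argument bounds `E_0[T_1]` by `(h + C) / c`: here `c` is a lower bound for the mean of one
log-likelihood ratio, and `C` bounds the overshoot and depends on `ρ` only, hence is uniform over
`S'`.

The quantum input is a lower bound for this mean when the true state is `τ` and the test uses `σ`
(`IsHayashiPVM.le_sum_born_mul_log`). The `ρ`-part is exact, because the basis diagonalizes `ρ^{⊗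
l}`. The `σ`-part loses at most `log m`, where `m` bounds the dimension of an irreducible subspace:
pinching gives `σ^{⊗ l} ≤ m • diagonal`, and the logarithm is operator monotone. The entries of
`A^{⊗ l}` are monomials of degree `l` in the `d²` entries of `A`, so `m = (l + 1) ^ (d * d)`
suffices. Thus `c ≥ l (D(τ‖ρ) - D(τ‖σ)) - d² log (l + 1)`, and the correction vanishes relative to
`l`. The finite family is the case `σ = τ`.

Hayashi bases exist because the tensor representation is closed under adjoints, hence splits
orthogonally into irreducible subspaces, on each of which `ρ^{⊗ l}` can be diagonalized. -/

/-! ### Matrices that are diagonal in an orthonormal basis -/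

/-- The matrix with eigenvalues `f i` in the orthonormal basis `e`. -/
noncomputable def diagIn {n ι : Type*} [Fintype n] [Fintype ι]
    (e : OrthonormalBasis ι ℂ (EuclideanSpace ℂ n)) (f : ι → ℝ) : Matrix n n ℂ :=
  ∑ i, (f i : ℂ) • Matrix.vecMulVec (e i).ofLp (star (e i).ofLp)

section DiagIn

variable {n ι κ : Type*} [Fintype n] [Fintype ι] [Fintype κ]
  (e : OrthonormalBasis ι ℂ (EuclideanSpace ℂ n)) (b : OrthonormalBasis κ ℂ (EuclideanSpace ℂ n))

theorem star_dotProduct_eq_inner (v w : n → ℂ) :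
    star v ⬝ᵥ w = inner ℂ (WithLp.toLp 2 v) (WithLp.toLp 2 w) := by
  rw [EuclideanSpace.inner_eq_star_dotProduct, dotProduct_comm]

theorem OrthonormalBasis.star_dotProduct [DecidableEq ι] (i j : ι) :
    star (e i).ofLp ⬝ᵥ (e j).ofLp = if i = j then 1 else 0 := by
  rw [star_dotProduct_eq_inner]
  exact orthonormal_iff_ite.mp e.orthonormal i j

theorem diagIn_mulVec (f : ι → ℝ) (v : n → ℂ) :
    diagIn e f *ᵥ v = ∑ i, ((f i : ℂ) * (star (e i).ofLp ⬝ᵥ v)) • (e i).ofLp := by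
  simp only [diagIn, Matrix.sum_mulVec, Matrix.smul_mulVec, Matrix.vecMulVec_mulVec]
  refine Finset.sum_congr rfl fun i _ => ?_
  ext k
  simp [mul_comm, mul_left_comm]

theorem diagIn_mulVec_basis (f : ι → ℝ) (i : ι) :
    diagIn e f *ᵥ (e i).ofLp = (f i : ℂ) • (e i).ofLp := by
  classical
  rw [diagIn_mulVec]
  simp [e.star_dotProduct]

theorem Matrix.ext_orthonormalBasis {A B : Matrix n n ℂ}
    (h : ∀ i, A *ᵥ (e i).ofLp = B *ᵥ (e i).ofLp) : A = B := by
  classical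
  apply (Matrix.toEuclideanLin (𝕜 := ℂ) (m := n) (n := n)).injective
  refine e.toBasis.ext fun i => ?_
  ext k
  simpa [Matrix.toLpLin_apply] using congrFun (h i) k

theorem eq_diagIn {A : Matrix n n ℂ} {f : ι → ℝ}
    (h : ∀ i, A *ᵥ (e i).ofLp = (f i : ℂ) • (e i).ofLp) : A = diagIn e f :=
  Matrix.ext_orthonormalBasis e fun i => by rw [h, diagIn_mulVec_basis]

theorem diagIn_add (f g : ι → ℝ) : diagIn e f + diagIn e g = diagIn e (fun i => f i + g i) :=
  eq_diagIn e fun i => by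
    rw [Matrix.add_mulVec, diagIn_mulVec_basis, diagIn_mulVec_basis, ← add_smul]
    push_cast; rfl

theorem diagIn_const [DecidableEq n] (c : ℝ) : diagIn e (fun _ => c) = (c : ℂ) • 1 :=
  (eq_diagIn e fun i => by rw [Matrix.smul_mulVec, Matrix.one_mulVec]).symm

theorem diagIn_isHermitian (f : ι → ℝ) : (diagIn e f).IsHermitian := by
  unfold diagIn
  refine Matrix.IsHermitian.ext fun i j => ?_
  simp [Matrix.sum_apply, Matrix.vecMulVec_apply, mul_comm]

theorem star_dotProduct_diagIn_mulVec (f : ι → ℝ) (v : n → ℂ) :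
    star v ⬝ᵥ (diagIn e f *ᵥ v) = ((∑ i, f i * ‖star (e i).ofLp ⬝ᵥ v‖ ^ 2 : ℝ) : ℂ) := by
  rw [diagIn_mulVec, dotProduct_sum]
  push_cast
  refine Finset.sum_congr rfl fun i _ => ?_
  rw [dotProduct_smul, smul_eq_mul, mul_assoc, ← Complex.mul_conj']
  congr 2
  rw [star_dotProduct_eq_inner, star_dotProduct_eq_inner, inner_conj_symm]

theorem diagIn_posSemidef {f : ι → ℝ} (hf : ∀ i, 0 ≤ f i) : (diagIn e f).PosSemidef := by
  refine .of_dotProduct_mulVec_nonneg (diagIn_isHermitian e f) fun v => ?_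
  rw [star_dotProduct_diagIn_mulVec]
  exact_mod_cast Finset.sum_nonneg fun i _ => mul_nonneg (hf i) (sq_nonneg _)

theorem diagIn_posDef [DecidableEq n] {f : ι → ℝ} (hf : ∀ i, 0 < f i) : (diagIn e f).PosDef := by
  have hinv : diagIn e f * diagIn e (fun i => (f i)⁻¹) = 1 :=
    Matrix.ext_orthonormalBasis e fun i => by
      rw [← Matrix.mulVec_mulVec, diagIn_mulVec_basis, Matrix.mulVec_smul, diagIn_mulVec_basis,
        smul_smul, Matrix.one_mulVec]
      have := (hf i).ne'
      push_cast
      rw [inv_mul_cancel₀ (by exact_mod_cast this), one_smul]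
  exact (diagIn_posSemidef e fun i => (hf i).le).posDef_iff_isUnit.mpr
    (IsUnit.of_mul_eq_one _ hinv)

theorem trace_mul_diagIn (A : Matrix n n ℂ) (f : ι → ℝ) :
    (A * diagIn e f).trace = ∑ i, (f i : ℂ) * (star (e i).ofLp ⬝ᵥ (A *ᵥ (e i).ofLp)) := by
  simp only [diagIn, Finset.mul_sum, Matrix.trace_sum, Matrix.mul_smul, Matrix.trace_smul,
    Matrix.mul_vecMulVec, Matrix.trace_vecMulVec, smul_eq_mul]
  refine Finset.sum_congr rfl fun i _ => ?_
  rw [dotProduct_comm]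

theorem Matrix.aeval_mulVec_of_eigenvector [DecidableEq n] {A : Matrix n n ℂ} {v : n → ℂ} {r : ℝ}
    (h : A *ᵥ v = (r : ℂ) • v) (p : Polynomial ℝ) :
    Polynomial.aeval A p *ᵥ v = ((p.eval r : ℝ) : ℂ) • v := by
  induction p using Polynomial.induction_on' with
  | add p q hp hq => rw [map_add, Matrix.add_mulVec, hp, hq, ← add_smul]; simp
  | monomial k a =>
    have hk : ∀ k : ℕ, A ^ k *ᵥ v = ((r : ℂ) ^ k) • v := fun k => by
      induction k with
      | zero => simp
      | succ k ih => rw [pow_succ, ← Matrix.mulVec_mulVec, h, Matrix.mulVec_smul, ih, smul_smul,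
          pow_succ']
    rw [Polynomial.aeval_monomial, ← Matrix.mulVec_mulVec, hk, Algebra.algebraMap_eq_smul_one,
      Matrix.smul_mulVec, Matrix.one_mulVec, Polynomial.eval_monomial]
    ext
    simp [mul_assoc]

/-- On the finite set of spectral points and values of `f`, `g` agrees with a Lagrange polynomial,
and polynomials act on eigenvectors by evaluation. -/
theorem cfc_diagIn [DecidableEq n] (g : ℝ → ℝ) (f : ι → ℝ) :
    cfc g (diagIn e f) = diagIn e (g ∘ f) := by
  classical
  have hfin : (spectrum ℝ (diagIn e f) ∪ Set.range f).Finite :=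
    Matrix.finite_real_spectrum.union (Set.finite_range f)
  set s := hfin.toFinset
  set p := Lagrange.interpolate s id g
  have hp : ∀ x ∈ s, p.eval x = g x := fun x hx =>
    Lagrange.eval_interpolate_at_node g (v := id) (fun _ _ _ _ h => h) hx
  have h1 : cfc g (diagIn e f) = cfc (fun x => p.eval x) (diagIn e f) :=
    cfc_congr fun x hx => (hp x (by simp [s]; exact Or.inl hx)).symm
  rw [h1, cfc_polynomial p _ (diagIn_isHermitian e f).isSelfAdjoint]
  refine eq_diagIn e fun i => ?_
  rw [Matrix.aeval_mulVec_of_eigenvector (diagIn_mulVec_basis e f i), hp _ (by simp [s])]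
  rfl

open scoped MatrixOrder in
-- With `A = Xᴴ X`, the difference of the traces is the trace of the positive matrix `X (C - B) Xᴴ`.
theorem Matrix.PosSemidef.trace_mul_le {A B C : Matrix n n ℂ} (hA : A.PosSemidef)
    (h : (C - B).PosSemidef) : (A * B).trace.re ≤ (A * C).trace.re := by
  classical
  obtain ⟨X, rfl⟩ := CStarAlgebra.nonneg_iff_eq_star_mul_self.mp hA.nonneg
  have h1 := (h.mul_mul_conjTranspose_same X).trace_nonneg
  rw [mul_assoc, Matrix.trace_mul_comm, mul_assoc, Matrix.sub_mul, Matrix.trace_sub] at h1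
  have h2 := (Complex.le_def.mp h1).1
  simp only [Complex.zero_re, Complex.sub_re] at h2
  rw [Matrix.trace_mul_comm _ B, Matrix.trace_mul_comm _ C]
  exact sub_nonneg.mp h2

open scoped MatrixOrder Matrix.Norms.L2Operator in
/-- Operator monotonicity of the logarithm. -/
theorem diagIn_log_le [DecidableEq n] {f : ι → ℝ} {g : κ → ℝ} (hf : ∀ i, 0 < f i)
    (h : (diagIn b g - diagIn e f).PosSemidef) :
    (diagIn b (Real.log ∘ g) - diagIn e (Real.log ∘ f)).PosSemidef := by
  have h1 : CFC.log (diagIn e f) ≤ CFC.log (diagIn b g) :=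
    CFC.log_le_log h (diagIn_posDef e hf).isStrictlyPositive
  rw [← cfc_diagIn, ← cfc_diagIn]
  exact h1

end DiagIn

/-! ### Pinching and monotonicity of the trace against a logarithm -/

section Pinching

variable {n ι κ : Type*} [Fintype n] [Fintype ι] [Fintype κ]
  (e : OrthonormalBasis ι ℂ (EuclideanSpace ℂ n)) (b : OrthonormalBasis κ ℂ (EuclideanSpace ℂ n))

theorem Matrix.IsHermitian.posSemidef_of_re_nonneg {A : Matrix n n ℂ} (hA : A.IsHermitian)
    (h : ∀ v : n → ℂ, 0 ≤ (star v ⬝ᵥ (A *ᵥ v)).re) : A.PosSemidef :=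
  .of_dotProduct_mulVec_nonneg hA fun v =>
    Complex.le_def.mpr ⟨h v, (hA.im_star_dotProduct_mulVec_self v).symm⟩

theorem OrthonormalBasis.sum_dotProduct_smul (v : n → ℂ) :
    ∑ i, (star (e i).ofLp ⬝ᵥ v) • (e i).ofLp = v := by
  have h := congrArg WithLp.ofLp (e.sum_repr' (WithLp.toLp 2 v))
  rw [WithLp.ofLp_sum] at h
  simpa only [WithLp.ofLp_smul, star_dotProduct_eq_inner] using h

/-- A positive semidefinite matrix with a block structure in the basis `b` is dominated by a
multiple of its diagonal, the factor being the maximal size of a block. -/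
theorem Matrix.PosSemidef.le_smul_diagonal {γ : Type*} [DecidableEq γ] {B : Matrix n n ℂ}
    (hB : B.PosSemidef) (c : κ → γ) (m : ℕ)
    (hc : ∀ x, (Finset.univ.filter fun y => c x = c y).card ≤ m)
    (h0 : ∀ x y, c x ≠ c y → star (b x).ofLp ⬝ᵥ (B *ᵥ (b y).ofLp) = 0) :
    (diagIn b (fun x => m * (star (b x).ofLp ⬝ᵥ (B *ᵥ (b x).ofLp)).re) - B).PosSemidef := by
  refine ((diagIn_isHermitian b _).sub hB.isHermitian).posSemidef_of_re_nonneg fun v => ?_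
  rw [Matrix.sub_mulVec, dotProduct_sub, Complex.sub_re, sub_nonneg,
    star_dotProduct_diagIn_mulVec, Complex.ofReal_re]
  set w : κ → n → ℂ := fun x => (star (b x).ofLp ⬝ᵥ v) • (b x).ofLp with hw
  set D : κ → ℝ := fun x => (star (w x) ⬝ᵥ (B *ᵥ w x)).re with hD
  have hDx : ∀ x, D x = ‖star (b x).ofLp ⬝ᵥ v‖ ^ 2 * (star (b x).ofLp ⬝ᵥ (B *ᵥ (b x).ofLp)).re := by
    intro x
    simp only [hD, hw, star_smul, smul_dotProduct, Matrix.mulVec_smul, dotProduct_smul, smul_eq_mul]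
    rw [← mul_assoc, Complex.star_def, Complex.mul_conj', ← Complex.ofReal_pow,
      Complex.re_ofReal_mul]
  have hD0 : ∀ x, 0 ≤ D x := fun x => (Complex.le_def.mp (hB.dotProduct_mulVec_nonneg (w x))).1
  -- Positivity of `B` on `w x - w y` bounds a pair of conjugate cross terms by the two diagonal
  -- terms.
  have hcross : ∀ x y, (star (w x) ⬝ᵥ (B *ᵥ w y)).re + (star (w y) ⬝ᵥ (B *ᵥ w x)).re
      ≤ D x + D y := by
    intro x y
    have h := (Complex.le_def.mp (hB.dotProduct_mulVec_nonneg (w x - w y))).1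
    simp only [Complex.zero_re, star_sub, Matrix.mulVec_sub, dotProduct_sub, sub_dotProduct,
      Complex.sub_re] at h
    simp only [hD]
    linarith
  have hzero : ∀ x y, c x ≠ c y → (star (w x) ⬝ᵥ (B *ᵥ w y)).re = 0 := by
    intro x y hxy
    simp only [hw, star_smul, smul_dotProduct, Matrix.mulVec_smul, dotProduct_smul, h0 x y hxy]
    simp
  have hv : v = ∑ x, w x := (b.sum_dotProduct_smul v).symm
  have hexp : (star v ⬝ᵥ (B *ᵥ v)).re = ∑ x, ∑ y, (star (w x) ⬝ᵥ (B *ᵥ w y)).re := by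
    conv_lhs => rw [hv]
    rw [star_sum, sum_dotProduct, Complex.re_sum]
    refine Finset.sum_congr rfl fun x _ => ?_
    rw [Matrix.mulVec_sum, dotProduct_sum, Complex.re_sum]
  -- Adding the double sum to its transpose pairs the conjugate terms; hence the doubled inequality
  -- `h3`.
  have hsym : (star v ⬝ᵥ (B *ᵥ v)).re = ∑ x, ∑ y, (star (w y) ⬝ᵥ (B *ᵥ w x)).re := by
    rw [hexp, Finset.sum_comm]
  have hle : ∀ x y, (star (w x) ⬝ᵥ (B *ᵥ w y)).re + (star (w y) ⬝ᵥ (B *ᵥ w x)).re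
      ≤ (if c x = c y then D x else 0) + (if c x = c y then D y else 0) := by
    intro x y
    split_ifs with h
    · exact hcross x y
    · rw [hzero x y h, hzero y x (Ne.symm h)]
  have h1 : ∑ x, ∑ y, (if c x = c y then D x else 0) ≤ ∑ x, m * D x := by
    refine Finset.sum_le_sum fun x _ => ?_
    rw [← Finset.sum_filter, Finset.sum_const, nsmul_eq_mul]
    exact mul_le_mul_of_nonneg_right (by exact_mod_cast hc x) (hD0 x)
  have h2 : ∑ x, ∑ y, (if c x = c y then D y else 0) ≤ ∑ x, m * D x := by
    rw [Finset.sum_comm]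
    simpa only [eq_comm] using h1
  have h3 : (star v ⬝ᵥ (B *ᵥ v)).re + (star v ⬝ᵥ (B *ᵥ v)).re ≤ ∑ x, m * D x + ∑ x, m * D x := by
    nth_rewrite 2 [hsym]
    rw [hexp, ← Finset.sum_add_distrib]
    refine le_trans (Finset.sum_le_sum fun x _ => ?_)
      (Finset.sum_add_distrib.trans_le (add_le_add h1 h2))
    rw [← Finset.sum_add_distrib, ← Finset.sum_add_distrib]
    exact Finset.sum_le_sum fun y _ => hle x y
  have h4 : ∑ x, m * D x
      = ∑ x, m * (star (b x).ofLp ⬝ᵥ (B *ᵥ (b x).ofLp)).re * ‖star (b x).ofLp ⬝ᵥ v‖ ^ 2 :=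
    Finset.sum_congr rfl fun x _ => by rw [hDx]; ring
  linarith

/-- `Real.log` is not continuous at `0`, but there the hypothesis makes the term vanish. This lets
an `ε`-regularization be removed. -/
theorem tendsto_mul_log_add {a c : ℝ} (h : a = 0 → c = 0) :
    Tendsto (fun ε : ℝ => Real.log (a + ε) * c) (𝓝[>] 0) (𝓝 (Real.log a * c)) := by
  by_cases ha : a = 0
  · simp [h ha]
  · have : ContinuousAt (fun ε : ℝ => Real.log (a + ε) * c) 0 := by
      refine (ContinuousAt.log (by fun_prop) (by simpa using ha)).mul_const c
    simpa using this.tendsto.mono_left nhdsWithin_le_nhds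

theorem trace_mul_diagIn_re (A : Matrix n n ℂ) (f : ι → ℝ) :
    (A * diagIn e f).trace.re = ∑ i, f i * (star (e i).ofLp ⬝ᵥ (A *ᵥ (e i).ofLp)).re := by
  simp [trace_mul_diagIn]

/-- Monotonicity of `B ↦ tr (A log B)`, with logarithms taken on the supports. -/
theorem trace_mul_diagIn_log_le {A : Matrix n n ℂ} (hA : A.PosSemidef) {f : ι → ℝ} {g : κ → ℝ}
    (hf : ∀ i, 0 ≤ f i) (h : (diagIn b g - diagIn e f).PosSemidef)
    (hfA : ∀ i, f i = 0 → (star (e i).ofLp ⬝ᵥ (A *ᵥ (e i).ofLp)).re = 0)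
    (hgA : ∀ x, g x = 0 → (star (b x).ofLp ⬝ᵥ (A *ᵥ (b x).ofLp)).re = 0) :
    (A * diagIn e (Real.log ∘ f)).trace.re ≤ (A * diagIn b (Real.log ∘ g)).trace.re := by
  classical
  rw [trace_mul_diagIn_re, trace_mul_diagIn_re]
  -- Operator monotonicity of the logarithm needs positive definite matrices: shift both by `ε` and
  -- let `ε → 0`.
  refine le_of_tendsto_of_tendsto
    (tendsto_finsetSum _ fun i _ => tendsto_mul_log_add (hfA i))
    (tendsto_finsetSum _ fun x _ => tendsto_mul_log_add (hgA x)) ?_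
  filter_upwards [self_mem_nhdsWithin] with ε hε
  have h1 := hA.trace_mul_le (diagIn_log_le e b (f := fun i => f i + ε) (g := fun x => g x + ε)
    (fun i => add_pos_of_nonneg_of_pos (hf i) hε) (by
      rw [← diagIn_add, ← diagIn_add, diagIn_const, diagIn_const, add_sub_add_right_eq_sub]
      exact h))
  rwa [trace_mul_diagIn_re, trace_mul_diagIn_re] at h1

end Pinching

/-! ### Tensor powers of states -/

/-- The product vector `v₁ ⊗ ⋯ ⊗ v_l`. -/
def prodVec {d l : ℕ} (v : Fin l → Fin d → ℂ) : (Fin l → Fin d) → ℂ := fun j => ∏ t, v t (j t)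

theorem tensorProd_mulVec_prodVec {d l : ℕ} (A : Fin l → Matrix (Fin d) (Fin d) ℂ)
    (v : Fin l → Fin d → ℂ) : tensorProd A *ᵥ prodVec v = prodVec fun t => A t *ᵥ v t := by
  ext i
  simp only [tensorProd, prodVec, Matrix.mulVec, dotProduct, Matrix.of_apply,
    ← Finset.prod_mul_distrib]
  rw [Finset.prod_univ_sum, Fintype.piFinset_univ]

theorem star_prodVec_dotProduct {d l : ℕ} (v w : Fin l → Fin d → ℂ) :
    star (prodVec v) ⬝ᵥ prodVec w = ∏ t, star (v t) ⬝ᵥ w t := by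
  simp only [prodVec, dotProduct, Pi.star_apply, star_prod, ← Finset.prod_mul_distrib]
  rw [Finset.prod_univ_sum, Fintype.piFinset_univ]

theorem prodVec_smul {d l : ℕ} (r : Fin l → ℂ) (v : Fin l → Fin d → ℂ) :
    prodVec (fun t => r t • v t) = (∏ t, r t) • prodVec v := by
  ext j
  simp [prodVec, Finset.prod_mul_distrib]

theorem orthonormal_prodVec {d : ℕ} (u : OrthonormalBasis (Fin d) ℂ (EuclideanSpace ℂ (Fin d)))
    (l : ℕ) : Orthonormal ℂ (fun I : Fin l → Fin d =>
      (WithLp.toLp 2 (prodVec fun t => (u (I t)).ofLp) : BlockSpace d l)) := by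
  rw [orthonormal_iff_ite]
  intro I J
  rw [← star_dotProduct_eq_inner, star_prodVec_dotProduct]
  simp only [u.star_dotProduct]
  rw [Fintype.prod_ite_zero]
  simp [funext_iff]

/-- The orthonormal basis of `(ℂ^d)^{⊗ l}` of all products of vectors from `u`. -/
noncomputable def tensorBasis {d : ℕ} (u : OrthonormalBasis (Fin d) ℂ (EuclideanSpace ℂ (Fin d)))
    (l : ℕ) : OrthonormalBasis (Fin l → Fin d) ℂ (BlockSpace d l) :=
  OrthonormalBasis.mk (orthonormal_prodVec u l) (by
    rw [(orthonormal_prodVec u l).linearIndependent.span_eq_top_of_card_eq_finrank' (by simp)])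

theorem tensorBasis_apply {d : ℕ} (u : OrthonormalBasis (Fin d) ℂ (EuclideanSpace ℂ (Fin d)))
    (l : ℕ) (I : Fin l → Fin d) :
    (tensorBasis u l I).ofLp = prodVec fun t => (u (I t)).ofLp := by
  rw [tensorBasis, OrthonormalBasis.coe_mk]

theorem tensorPow_diagIn {d : ℕ} (u : OrthonormalBasis (Fin d) ℂ (EuclideanSpace ℂ (Fin d)))
    (r : Fin d → ℝ) (l : ℕ) :
    tensorPow (diagIn u r) l = diagIn (tensorBasis u l) (fun I => ∏ t, r (I t)) := by
  refine eq_diagIn _ fun I => ?_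
  rw [tensorBasis_apply, tensorPow, tensorProd_mulVec_prodVec]
  simp only [diagIn_mulVec_basis]
  rw [prodVec_smul]
  push_cast
  rfl

theorem QState.exists_diagIn {d : ℕ} (τ : QState d) :
    ∃ (u : OrthonormalBasis (Fin d) ℂ (EuclideanSpace ℂ (Fin d))) (r : Fin d → ℝ),
      (∀ i, 0 ≤ r i) ∧ τ.mat = diagIn u r :=
  ⟨τ.posSemidef.isHermitian.eigenvectorBasis, τ.posSemidef.isHermitian.eigenvalues,
    τ.posSemidef.eigenvalues_nonneg,
    eq_diagIn _ fun i => by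
      rw [τ.posSemidef.isHermitian.mulVec_eigenvectorBasis]
      ext
      simp⟩

theorem tensorPow_posSemidef {d : ℕ} (σ : QState d) (l : ℕ) : (tensorPow σ.mat l).PosSemidef :=
  tensorProd_posSemidef fun _ => σ

theorem born_const {d l : ℕ} (b : BlockPVM d l) (σ : QState d) (x : Fin (d ^ l)) :
    born b (fun _ => σ) x = (star (b x).ofLp ⬝ᵥ (tensorPow σ.mat l *ᵥ (b x).ofLp)).re := by
  rw [born, effect_mul_trace]; rfl

/-- The kernel of `τ^{⊗ l}` is spanned by the product eigenvectors with a factor in `ker τ`, and `σ`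
kills that factor. -/
theorem SuppLE.tensorPow_mulVec_eq_zero {d l : ℕ} {σ τ : QState d} (h : SuppLE σ τ)
    {v : (Fin l → Fin d) → ℂ} (hv : tensorPow τ.mat l *ᵥ v = 0) : tensorPow σ.mat l *ᵥ v = 0 := by
  obtain ⟨u, r, hr, hτ⟩ := τ.exists_diagIn
  set e := tensorBasis u l
  rw [← e.sum_dotProduct_smul v, Matrix.mulVec_sum]
  refine Finset.sum_eq_zero fun I _ => ?_
  rw [Matrix.mulVec_smul]
  by_cases hI : ∏ t, r (I t) = 0
  · obtain ⟨t, -, ht⟩ := Finset.prod_eq_zero_iff.mp hI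
    have h1 : σ.mat *ᵥ (u (I t)).ofLp = 0 := h _ (by rw [hτ, diagIn_mulVec_basis, ht]; simp)
    have h2 : tensorPow σ.mat l *ᵥ (e I).ofLp = 0 := by
      rw [tensorBasis_apply, tensorPow, tensorProd_mulVec_prodVec]
      ext j
      exact Finset.prod_eq_zero (Finset.mem_univ t) (congrFun h1 (j t))
    rw [h2, smul_zero]
  · have h1 : star (e I).ofLp ⬝ᵥ (tensorPow τ.mat l *ᵥ v) = 0 := by rw [hv, dotProduct_zero]
    rw [hτ, tensorPow_diagIn, diagIn_mulVec, dotProduct_sum] at h1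
    simp only [dotProduct_smul, smul_eq_mul] at h1
    rw [Finset.sum_eq_single I] at h1
    · rw [e.star_dotProduct, if_pos rfl, mul_one] at h1
      rcases mul_eq_zero.mp h1 with h1 | h1
      · exact absurd (by exact_mod_cast h1) hI
      · rw [h1, zero_smul]
    · intro J _ hJ
      change _ * (star (e I).ofLp ⬝ᵥ (e J).ofLp) = 0
      rw [e.star_dotProduct, if_neg (Ne.symm hJ), mul_zero]
    · simp

open scoped MatrixOrder in
theorem Matrix.PosSemidef.mulVec_eq_zero_of_re {n : Type*} [Fintype n] {A : Matrix n n ℂ}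
    (hA : A.PosSemidef) {v : n → ℂ} (h : (star v ⬝ᵥ (A *ᵥ v)).re = 0) : A *ᵥ v = 0 :=
  (hA.dotProduct_mulVec_zero_iff v).mp
    (Complex.ext h (hA.isHermitian.im_star_dotProduct_mulVec_self v))

/-- Absolute continuity of the outcome laws: a vector on which a positive form vanishes lies in its
kernel. -/
theorem SuppLE.born_eq_zero {d l : ℕ} {σ τ : QState d} (h : SuppLE σ τ) (b : BlockPVM d l)
    {x : Fin (d ^ l)} (hx : born b (fun _ => τ) x = 0) : born b (fun _ => σ) x = 0 := by
  rw [born_const] at hx ⊢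
  rw [h.tensorPow_mulVec_eq_zero ((tensorPow_posSemidef τ l).mulVec_eq_zero_of_re hx),
    dotProduct_zero, Complex.zero_re]

/-- A marginal of a product weight: expand a product of sums in which `g` is inserted in the factor
`t` only. -/
theorem sum_mul_prod_eq {ι : Type*} [Fintype ι] {l : ℕ} (a g : ι → ℝ) (ha : ∑ i, a i = 1)
    (t : Fin l) : ∑ I : Fin l → ι, g (I t) * ∏ s, a (I s) = ∑ i, g i * a i := by
  classical
  have h := Finset.prod_univ_sum (fun _ : Fin l => (Finset.univ : Finset ι))
    (fun s i => (if s = t then g i else 1) * a i)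
  rw [Fintype.piFinset_univ] at h
  simp only [Finset.prod_mul_distrib, Finset.prod_ite_eq', Finset.mem_univ, if_true] at h
  rw [← h, Finset.prod_eq_single t]
  · simp
  · intro s _ hs
    simp [hs, ha]
  · simp

/-- Additivity: the diagonal of `σ^{⊗ l}` in the product eigenbasis of `τ` is a product weight, and
the logarithm of a product of eigenvalues is a sum. If an eigenvalue vanishes, so does the weight,
by the support condition. -/
theorem trace_tensorPow_mul_log {d l : ℕ} {σ τ : QState d} (h : SuppLE σ τ)
    {u : OrthonormalBasis (Fin d) ℂ (EuclideanSpace ℂ (Fin d))} {r : Fin d → ℝ}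
    (hτ : τ.mat = diagIn u r) :
    (tensorPow σ.mat l * diagIn (tensorBasis u l) (Real.log ∘ fun I => ∏ t, r (I t))).trace.re
      = l * (σ.mat * cfc Real.log τ.mat).trace.re := by
  set a : Fin d → ℝ := fun i => (star (u i).ofLp ⬝ᵥ (σ.mat *ᵥ (u i).ofLp)).re with ha
  have hac : ∀ i, star (u i).ofLp ⬝ᵥ (σ.mat *ᵥ (u i).ofLp) = (a i : ℂ) := fun i =>
    Complex.ext rfl (σ.posSemidef.isHermitian.im_star_dotProduct_mulVec_self _)
  have ha1 : ∑ i, a i = 1 := by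
    have h1 := trace_mul_diagIn_re u σ.mat (fun _ => 1)
    rw [diagIn_const] at h1
    simpa [σ.trace_eq_one] using h1.symm
  have ha0 : ∀ i, r i = 0 → a i = 0 := fun i hi => by
    simp only [ha]
    rw [h _ (by rw [hτ, diagIn_mulVec_basis, hi]; simp), dotProduct_zero, Complex.zero_re]
  rw [hτ, cfc_diagIn, trace_mul_diagIn_re, trace_mul_diagIn_re]
  have h1 : ∀ I : Fin l → Fin d, (star (tensorBasis u l I).ofLp ⬝ᵥ
      (tensorPow σ.mat l *ᵥ (tensorBasis u l I).ofLp)).re = ∏ t, a (I t) := fun I => by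
    rw [tensorBasis_apply, tensorPow, tensorProd_mulVec_prodVec, star_prodVec_dotProduct]
    simp only [hac]
    rw [← Complex.ofReal_prod, Complex.ofReal_re]
  have h2 : ∀ I : Fin l → Fin d, Real.log (∏ t, r (I t)) * ∏ t, a (I t)
      = ∑ t, Real.log (r (I t)) * ∏ s, a (I s) := fun I => by
    by_cases hI : ∃ t, r (I t) = 0
    · obtain ⟨t, ht⟩ := hI
      rw [Finset.prod_eq_zero (f := fun t => a (I t)) (Finset.mem_univ t) (ha0 _ ht)]
      simp
    · push Not at hI
      rw [Real.log_prod (fun t _ => hI t), Finset.sum_mul]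
  simp only [Function.comp_apply, h1, h2]
  rw [Finset.sum_comm]
  simp only [fun t => sum_mul_prod_eq a (fun i => Real.log (r i)) ha1 t]
  simp [ha]

/-! ### Irreducible subspaces of the tensor representation -/

theorem tensorPow_apply_eq_prod_count {d l : ℕ} (A : Matrix (Fin d) (Fin d) ℂ)
    (i j : Fin l → Fin d) :
    tensorPow A l i j
      = ∏ p : Fin d × Fin d, A p.1 p.2 ^ (Finset.univ.filter fun t => (i t, j t) = p).card := by
  rw [tensorPow, tensorProd, Matrix.of_apply,
    ← Finset.prod_fiberwise Finset.univ (fun t => (i t, j t)) (fun t => A (i t) (j t))]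
  refine Finset.prod_congr rfl fun p _ => ?_
  rw [Finset.prod_congr rfl (g := fun _ => A p.1 p.2), Finset.prod_const]
  rintro t ht
  rw [← (Finset.mem_filter.mp ht).2]

/-- The number of occurrences of each pair in a pair of multi-indices. -/
def pairCount {d l : ℕ} (i j : Fin l → Fin d) : Fin d × Fin d → Fin (l + 1) := fun p =>
  ⟨(Finset.univ.filter fun t => (i t, j t) = p).card,
    Nat.lt_succ_of_le ((Finset.card_le_univ _).trans_eq (Fintype.card_fin l))⟩

/-- Only the coefficients depend on `A`, so the whole orbit of `w` lies in the span of `(l + 1) ^ (d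
* d)` fixed vectors. -/
theorem tensorPow_mulVec_eq_sum {d l : ℕ} (A : Matrix (Fin d) (Fin d) ℂ)
    (w : (Fin l → Fin d) → ℂ) :
    tensorPow A l *ᵥ w = ∑ τ : Fin d × Fin d → Fin (l + 1),
      (∏ p, A p.1 p.2 ^ (τ p : ℕ)) •
        fun i => ∑ j ∈ Finset.univ.filter (fun j => pairCount i j = τ), w j := by
  ext i
  simp only [Matrix.mulVec, dotProduct, Finset.sum_apply, Pi.smul_apply, smul_eq_mul]
  rw [← Finset.sum_fiberwise Finset.univ (fun j => pairCount i j)]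
  refine Finset.sum_congr rfl fun τ _ => ?_
  rw [Finset.mul_sum]
  refine Finset.sum_congr rfl fun j hj => ?_
  rw [tensorPow_apply_eq_prod_count, ← (Finset.mem_filter.mp hj).2]
  rfl

theorem tensorPow_mul {d : ℕ} (A B : Matrix (Fin d) (Fin d) ℂ) (l : ℕ) :
    tensorPow A l * tensorPow B l = tensorPow (A * B) l :=
  tensorProd_mul _ _

theorem tensorPow_one {d : ℕ} (l : ℕ) : tensorPow (1 : Matrix (Fin d) (Fin d) ℂ) l = 1 := by
  ext i j
  simp only [tensorPow, tensorProd, Matrix.of_apply, Matrix.one_apply, Fintype.prod_ite_zero]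
  simp [funext_iff]

theorem toEuclideanLin_tensorPow_comp {d l : ℕ} (A B : Matrix (Fin d) (Fin d) ℂ)
    (w : BlockSpace d l) :
    Matrix.toEuclideanLin (tensorPow A l) (Matrix.toEuclideanLin (tensorPow B l) w)
      = Matrix.toEuclideanLin (tensorPow (A * B) l) w := by
  simp [Matrix.toLpLin_apply, Matrix.mulVec_mulVec, tensorPow_mul]

/-- The span of the orbit is invariant since tensor powers multiply, and contains `w` (take `A =
1`), so irreducibility applies. -/
theorem TensorIrreducible.eq_span {d l : ℕ} {W : Submodule ℂ (BlockSpace d l)}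
    (hW : TensorIrreducible W) {w : BlockSpace d l} (hw : w ∈ W) (h0 : w ≠ 0) :
    Submodule.span ℂ (Set.range fun A : Matrix (Fin d) (Fin d) ℂ =>
      Matrix.toEuclideanLin (tensorPow A l) w) = W := by
  set V := Submodule.span ℂ (Set.range fun A : Matrix (Fin d) (Fin d) ℂ =>
      Matrix.toEuclideanLin (tensorPow A l) w)
  have hVW : V ≤ W := Submodule.span_le.mpr (by rintro _ ⟨A, rfl⟩; exact hW.1 A w hw)
  have hV : TensorInvariant V := fun A v hv => by
    refine (Submodule.span_le (p := V.comap (Matrix.toEuclideanLin (tensorPow A l)))).mpr ?_ hv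
    rintro _ ⟨B, rfl⟩
    refine Submodule.subset_span ⟨A * B, ?_⟩
    exact (toEuclideanLin_tensorPow_comp A B w).symm
  refine (hW.2.2 V hVW hV).resolve_left fun hbot => h0 ?_
  have : w ∈ V := Submodule.subset_span ⟨1, by simp [tensorPow_one]⟩
  rwa [hbot, Submodule.mem_bot] at this

/-- The dimension of an irreducible subspace of the tensor representation grows at most
polynomially in the number of factors. -/
theorem TensorIrreducible.finrank_le {d l : ℕ} {W : Submodule ℂ (BlockSpace d l)}
    (hW : TensorIrreducible W) : Module.finrank ℂ W ≤ (l + 1) ^ (d * d) := by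
  obtain ⟨w, hw, h0⟩ := Submodule.exists_mem_ne_zero_of_ne_bot hW.2.1
  rw [← hW.eq_span hw h0]
  set f : (Fin d × Fin d → Fin (l + 1)) → BlockSpace d l := fun τ =>
    WithLp.toLp 2 fun i => ∑ j ∈ Finset.univ.filter (fun j => pairCount i j = τ), w.ofLp j
  calc _ ≤ Module.finrank ℂ (Submodule.span ℂ (Set.range f)) := by
        refine Submodule.finrank_mono (Submodule.span_le.mpr ?_)
        rintro _ ⟨A, rfl⟩
        have : Matrix.toEuclideanLin (tensorPow A l) w
            = ∑ τ, (∏ p, A p.1 p.2 ^ (τ p : ℕ)) • f τ := by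
          rw [Matrix.toLpLin_apply, tensorPow_mulVec_eq_sum, WithLp.toLp_sum]
          rfl
        simp only [this]
        exact Submodule.sum_mem _ fun τ _ =>
          Submodule.smul_mem _ _ (Submodule.subset_span ⟨τ, rfl⟩)
    _ ≤ Fintype.card (Fin d × Fin d → Fin (l + 1)) := finrank_range_le_card f
    _ = (l + 1) ^ (d * d) := by simp

/-! ### Mean log-likelihood ratio of a Hayashi measurement -/

section Hayashi

variable {d l : ℕ} {ρ : QState d} {b : BlockPVM d l}

/-- The lower bound on the mean log-likelihood ratio of a block outcome. -/
theorem IsHayashiPVM.le_sum_born_mul_log (hb : IsHayashiPVM ρ b) {σ τ : QState d}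
    (hρ : SuppLE τ ρ) (hσ : SuppLE τ σ) :
    l * (τ.mat * (cfc Real.log σ.mat - cfc Real.log ρ.mat)).trace.re
        - d * d * Real.log (l + 1)
      ≤ ∑ x, born b (fun _ => τ) x *
          (Real.log (born b (fun _ => σ) x) - Real.log (born b (fun _ => ρ) x)) := by
  obtain ⟨c, hc⟩ := hb.irreducible
  set m : ℕ := (l + 1) ^ (d * d) with hm
  have hA := tensorPow_posSemidef τ l
  -- the part that depends on `ρ`
  have h1 : ∑ x, born b (fun _ => τ) x * Real.log (born b (fun _ => ρ) x)
      = l * (τ.mat * cfc Real.log ρ.mat).trace.re := by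
    obtain ⟨u, r, -, hu⟩ := ρ.exists_diagIn
    have hb2 : tensorPow ρ.mat l = diagIn b (born b fun _ => ρ) := by
      refine eq_diagIn b fun x => ?_
      obtain ⟨z, hz⟩ := hb.eigenvector x
      have hz' : tensorPow ρ.mat l *ᵥ (b x).ofLp = z • (b x).ofLp := by
        simpa [Matrix.toLpLin_apply] using congrArg WithLp.ofLp hz
      have hz2 : star (b x).ofLp ⬝ᵥ (tensorPow ρ.mat l *ᵥ (b x).ofLp) = z := by
        rw [hz', dotProduct_smul, b.star_dotProduct, if_pos rfl, smul_eq_mul, mul_one]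
      rw [hz', born_const, hz2]
      congr 1
      rw [← hz2]
      exact Complex.ext rfl ((tensorPow_posSemidef ρ l).isHermitian.im_star_dotProduct_mulVec_self _)
    rw [← trace_tensorPow_mul_log hρ hu, ← cfc_diagIn, ← tensorPow_diagIn, ← hu, hb2, cfc_diagIn,
      trace_mul_diagIn_re]
    exact Finset.sum_congr rfl fun x _ => by rw [born_const, mul_comm]; rfl
  -- the part that depends on `σ`
  have h2 : l * (τ.mat * cfc Real.log σ.mat).trace.re
      ≤ ∑ x, born b (fun _ => τ) x * Real.log (born b (fun _ => σ) x) + Real.log m := by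
    obtain ⟨u, r, hr, hu⟩ := σ.exists_diagIn
    rw [← trace_tensorPow_mul_log hσ hu]
    have hB := tensorPow_posSemidef σ l
    -- The blocks are the irreducible subspaces: their dimension bounds the block size, and their
    -- invariance under `σ^{⊗ l}` kills the entries between different blocks.
    have hpinch := hB.le_smul_diagonal b c m (fun x => by
      have h3 := finrank_span_eq_card (b.orthonormal.linearIndependent.comp
        (Subtype.val : {y // c y = c x} → _) Subtype.val_injective)
      have hran : Set.range (Subtype.val : {y // c y = c x} → _) = {y | c y = c x} :=
        Subtype.range_coe_subtype
      rw [Set.range_comp, hran] at h3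
      simp only [eq_comm (a := c x)]
      rw [← Fintype.card_subtype, ← h3]
      exact (hc x).finrank_le) (fun x y hxy => by
      have h3 : Matrix.toEuclideanLin (tensorPow σ.mat l) (b y) ∈
          Submodule.span ℂ (b '' {z | c z = c y}) :=
        (hc y).1 σ.mat _ (Submodule.subset_span ⟨y, rfl, rfl⟩)
      rw [star_dotProduct_eq_inner]
      refine Submodule.span_induction (p := fun v _ => inner ℂ (b x) v = 0) ?_ ?_ ?_ ?_ h3
      · rintro _ ⟨z, hz, rfl⟩
        rw [orthonormal_iff_ite.mp b.orthonormal, if_neg]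
        rintro rfl
        exact hxy hz
      · simp
      · intro v w _ _ hv hw; rw [inner_add_right, hv, hw, add_zero]
      · intro a v _ hv; rw [inner_smul_right, hv, mul_zero])
    have hm0 : (m : ℝ) ≠ 0 := by positivity
    have h4 := trace_mul_diagIn_log_le (tensorBasis u l) b hA
      (f := fun I => ∏ t, r (I t)) (g := fun x => m * born b (fun _ => σ) x)
      (fun I => Finset.prod_nonneg fun t _ => hr _)
      (by simpa only [born_const, hu, tensorPow_diagIn] using hpinch) (fun I hI => by
        rw [hσ.tensorPow_mulVec_eq_zero, dotProduct_zero, Complex.zero_re]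
        rw [hu, tensorPow_diagIn, diagIn_mulVec_basis, hI, Complex.ofReal_zero, zero_smul])
      (fun x hx => by
        rw [← born_const]
        exact hσ.born_eq_zero b ((mul_eq_zero.mp hx).resolve_left hm0))
    refine h4.trans_eq ?_
    rw [trace_mul_diagIn_re]
    have h5 : Real.log m = ∑ x, born b (fun _ => τ) x * Real.log m := by
      rw [← Finset.sum_mul, born_sum, one_mul]
    rw [h5, ← Finset.sum_add_distrib]
    refine Finset.sum_congr rfl fun x _ => ?_
    rw [← born_const, Function.comp_apply]
    by_cases h6 : born b (fun _ => σ) x = 0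
    · rw [hσ.born_eq_zero b h6]; simp
    · rw [Real.log_mul hm0 h6]; ring
  have h3 : Real.log m = d * d * Real.log (l + 1) := by
    rw [hm]; push_cast; rw [Real.log_pow]; push_cast; ring
  rw [Matrix.mul_sub, Matrix.trace_sub, Complex.sub_re]
  simp only [mul_sub, Finset.sum_sub_distrib]
  rw [h1, ← h3]
  linarith

end Hayashi

/-! ### Existence of Hayashi measurements -/

theorem tensorPow_conjTranspose {d : ℕ} (A : Matrix (Fin d) (Fin d) ℂ) (l : ℕ) :
    (tensorPow A l)ᴴ = tensorPow Aᴴ l :=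
  tensorProd_conjTranspose _

/-- The adjoint of `A^{⊗ l}` is the tensor power of `Aᴴ`, which also preserves `W`. -/
theorem TensorInvariant.orthogonal {d l : ℕ} {W : Submodule ℂ (BlockSpace d l)}
    (hW : TensorInvariant W) : TensorInvariant Wᗮ := by
  intro A v hv
  rw [Submodule.mem_orthogonal]
  intro w hw
  rw [← LinearMap.adjoint_inner_left, ← Matrix.toEuclideanLin_conjTranspose_eq_adjoint,
    tensorPow_conjTranspose]
  exact Submodule.inner_right_of_mem_orthogonal (hW Aᴴ w hw) hv

theorem TensorInvariant.exists_irreducible_le {d l : ℕ} {V : Submodule ℂ (BlockSpace d l)}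
    (hV : TensorInvariant V) (h0 : V ≠ ⊥) : ∃ W ≤ V, TensorIrreducible W := by
  obtain ⟨W, ⟨hWV, hW, hW0⟩, hmin⟩ := wellFounded_lt.has_min
    {W : Submodule ℂ (BlockSpace d l) | W ≤ V ∧ TensorInvariant W ∧ W ≠ ⊥} ⟨V, le_rfl, hV, h0⟩
  refine ⟨W, hWV, hW, hW0, fun U hU hUi => or_iff_not_imp_left.mpr fun hU0 => ?_⟩
  by_contra hne
  exact hmin U ⟨hU.trans hWV, hUi, hU0⟩ (lt_of_le_of_ne hU hne)

theorem TensorInvariant.exists_eigenbasis {d l : ℕ} (ρ : QState d)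
    {W : Submodule ℂ (BlockSpace d l)} (hW : TensorInvariant W) :
    ∃ s : Set (BlockSpace d l), (∀ v ∈ s, ∀ w ∈ s, inner ℂ v w = if v = w then (1 : ℂ) else 0) ∧
      Submodule.span ℂ s = W ∧
      ∀ v ∈ s, ∃ r : ℂ, Matrix.toEuclideanLin (tensorPow ρ.mat l) v = r • v := by
  have hT : (Matrix.toEuclideanLin (tensorPow ρ.mat l)).IsSymmetric :=
    Matrix.isSymmetric_toEuclideanLin_iff.mpr (tensorPow_posSemidef ρ l).isHermitian
  have hTW := hT.restrict_invariant (hW ρ.mat)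
  set e := hTW.eigenvectorBasis rfl
  refine ⟨Set.range fun i => (e i : BlockSpace d l), ?_, ?_, ?_⟩
  · rw [← orthonormal_subtype_iff_ite]
    exact (e.orthonormal.comp_linearIsometry W.subtypeₗᵢ).toSubtypeRange
  · have h := congrArg (Submodule.map W.subtype) e.toBasis.span_eq
    rw [Submodule.map_span, ← Set.range_comp, Submodule.map_top, Submodule.range_subtype] at h
    refine Eq.trans ?_ h
    congr 2
  · rintro _ ⟨i, rfl⟩
    exact ⟨_, congrArg Subtype.val (hTW.apply_eigenvectorBasis rfl i)⟩

/-- Induction on the dimension: split off an irreducible `W ≤ V`, take an eigenbasis of `ρ^{⊗ l}` in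
`W`, and continue in `Wᗮ ⊓ V`. -/
theorem TensorInvariant.exists_hayashi_basis {d l : ℕ} (ρ : QState d) (n : ℕ)
    {V : Submodule ℂ (BlockSpace d l)} (hV : TensorInvariant V) (hn : Module.finrank ℂ V = n) :
    ∃ s : Set (BlockSpace d l), (∀ v ∈ s, ∀ w ∈ s, inner ℂ v w = if v = w then (1 : ℂ) else 0) ∧
      Submodule.span ℂ s = V ∧
      (∀ v ∈ s, ∃ r : ℂ, Matrix.toEuclideanLin (tensorPow ρ.mat l) v = r • v) ∧
      ∃ c : BlockSpace d l → ℕ, ∀ x ∈ s,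
        TensorIrreducible (Submodule.span ℂ {y | y ∈ s ∧ c y = c x}) := by
  classical
  induction n using Nat.strong_induction_on generalizing V with
  | _ n ih =>
  by_cases h0 : V = ⊥
  · exact ⟨∅, by simp, by simp [h0], by simp, 0, by simp⟩
  obtain ⟨W, hWV, hW⟩ := hV.exists_irreducible_le h0
  obtain ⟨s₁, ho₁, hs₁, he₁⟩ := hW.1.exists_eigenbasis ρ
  have hU : TensorInvariant (Wᗮ ⊓ V) := fun A v hv => ⟨hW.1.orthogonal A v hv.1, hV A v hv.2⟩
  have hlt : Wᗮ ⊓ V < V := by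
    refine lt_of_le_of_ne inf_le_right fun h => hW.2.1 ?_
    have h1 : W ≤ Wᗮ := hWV.trans (inf_eq_right.mp h)
    exact (Submodule.isOrtho_self).mp h1
  obtain ⟨s₂, ho₂, hs₂, he₂, c, hc⟩ :=
    ih _ (hn ▸ Submodule.finrank_lt_finrank_of_lt hlt) hU rfl
  have h12 : ∀ v ∈ s₁, ∀ w ∈ s₂, inner ℂ v w = (0 : ℂ) := fun v hv w hw => by
    have hv' : v ∈ W := hs₁ ▸ Submodule.subset_span hv
    have hw' : w ∈ Wᗮ ⊓ V := hs₂ ▸ Submodule.subset_span hw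
    exact Submodule.inner_right_of_mem_orthogonal hv' hw'.1
  have hdisj : ∀ v ∈ s₂, v ∉ s₁ := fun v h2 h1 => by
    have h3 := h12 v h1 v h2
    rw [ho₁ v h1 v h1, if_pos rfl] at h3
    exact one_ne_zero h3
  -- Label `0` marks the new subspace; the old labels are shifted by one to keep the classes apart.
  refine ⟨s₁ ∪ s₂, ?_, ?_, ?_, fun y => if y ∈ s₁ then 0 else c y + 1, ?_⟩
  · rintro v (hv | hv) w (hw | hw)
    · exact ho₁ v hv w hw
    · rw [h12 v hv w hw, if_neg]
      rintro rfl
      exact hdisj v hw hv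
    · rw [← inner_conj_symm, h12 w hw v hv, map_zero, if_neg]
      rintro rfl
      exact hdisj v hv hw
    · exact ho₂ v hv w hw
  · rw [Submodule.span_union, hs₁, hs₂]
    exact Submodule.sup_orthogonal_inf_of_hasOrthogonalProjection hWV
  · rintro v (hv | hv)
    exacts [he₁ v hv, he₂ v hv]
  · rintro x (hx | hx)
    · have h1 : {y | y ∈ s₁ ∪ s₂ ∧ (if y ∈ s₁ then 0 else c y + 1)
          = if x ∈ s₁ then 0 else c x + 1} = s₁ := by
        ext y
        simp only [Set.mem_ofPred_eq, if_pos hx]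
        constructor
        · rintro ⟨-, hy⟩
          by_contra hy1
          simp [hy1] at hy
        · exact fun hy => ⟨Or.inl hy, if_pos hy⟩
      rw [h1, hs₁]
      exact hW
    · have h1 : {y | y ∈ s₁ ∪ s₂ ∧ (if y ∈ s₁ then 0 else c y + 1)
          = if x ∈ s₁ then 0 else c x + 1} = {y | y ∈ s₂ ∧ c y = c x} := by
        ext y
        simp only [Set.mem_ofPred_eq, if_neg (hdisj x hx)]
        constructor
        · rintro ⟨hy, hy2⟩
          by_cases hy1 : y ∈ s₁
          · simp [hy1] at hy2
          · exact ⟨hy.resolve_left hy1, by simpa [hy1] using hy2⟩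
        · rintro ⟨hy, hy2⟩
          exact ⟨Or.inr hy, by rw [if_neg (hdisj y hy), hy2]⟩
      rw [h1]
      exact hc x hx

theorem exists_isHayashiPVM {d : ℕ} (ρ : QState d) (l : ℕ) :
    ∃ b : BlockPVM d l, IsHayashiPVM ρ b := by
  obtain ⟨s, ho, hs, he, c, hc⟩ := TensorInvariant.exists_hayashi_basis (l := l) ρ _
    (V := ⊤) (fun _ _ _ => trivial) rfl
  have ho' : Orthonormal ℂ (Subtype.val : s → BlockSpace d l) :=
    orthonormal_subtype_iff_ite.mpr ho
  have hfin : s.Finite := ho'.linearIndependent.setFinite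
  have := hfin.fintype
  set b₀ : OrthonormalBasis s ℂ (BlockSpace d l) :=
    OrthonormalBasis.mk ho' (by rw [Subtype.range_val, hs])
  have hcard : Fintype.card s = d ^ l := by
    rw [← Module.finrank_eq_card_basis b₀.toBasis]
    simp
  set b : BlockPVM d l := b₀.reindex (Fintype.equivFinOfCardEq hcard)
  have hb : ∀ x, b x = ((Fintype.equivFinOfCardEq hcard).symm x : BlockSpace d l) := fun x => by
    simp [b, b₀]
  have hmem : ∀ x, b x ∈ s := fun x => by rw [hb]; exact Subtype.coe_prop _
  refine ⟨b, fun x => he _ (hmem x), fun x => c (b x), fun x => ?_⟩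
  have h1 : b '' {y | c (b y) = c (b x)} = {y | y ∈ s ∧ c y = c (b x)} := by
    ext v
    constructor
    · rintro ⟨y, hy, rfl⟩
      exact ⟨hmem y, hy⟩
    · rintro ⟨hv, hv2⟩
      have : b (Fintype.equivFinOfCardEq hcard ⟨v, hv⟩) = v := by simp [hb]
      exact ⟨_, by simpa [this] using hv2, this⟩
  rw [h1]
  exact hc _ (hmem x)

/-! ### Independent sequences with finitely many values -/

theorem measurable_domRestrict_range {α : Type*} [MeasurableSpace α] (n : ℕ) :
    Measurable (Set.domRestrict (Finset.range n : Set ℕ) : (ℕ → α) → _) :=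
  measurable_pi_lambda _ fun _ => measurable_pi_apply _

theorem measurable_shift {α : Type*} [MeasurableSpace α] (m : ℕ) : Measurable fun (ω : ℕ → α) i => ω (i + m) :=
  measurable_pi_lambda _ fun _ => measurable_pi_apply _

theorem ENat.toENNReal_eq_tsum (T : ℕ∞) :
    (T : ℝ≥0∞) = ∑' n : ℕ, if (n : ℕ∞) < T then 1 else 0 := by
  induction T using ENat.recTopCoe with
  | top => simp
  | coe k =>
    rw [tsum_eq_sum (s := Finset.range k) (fun n hn => by simpa using hn)]
    rw [Finset.sum_congr rfl fun n hn => if_pos (by simpa using hn)]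
    simp

/-- The drift criterion: if `V` decreases on average by `c` in each step before `T`, then the mean
of `T` is at most the initial value of `V` divided by `c`. -/
theorem mul_lintegral_le_of_drift {Ω : Type*} [MeasurableSpace Ω] {P : Measure Ω} [IsProbabilityMeasure P]
    {T : Ω → ℕ∞} {V : ℕ → Ω → ℝ≥0∞} {c v : ℝ≥0∞}
    (hT : ∀ n : ℕ, MeasurableSet {ω | (n : ℕ∞) < T ω}) 
    (h0 : ∀ ω, V 0 ω ≤ v)
    (hstep : ∀ n : ℕ, ∫⁻ ω in {ω | (n : ℕ∞) < T ω}, V (n + 1) ω + c ∂P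
      ≤ ∫⁻ ω in {ω | (n : ℕ∞) < T ω}, V n ω ∂P) :
    c * ∫⁻ ω, (T ω : ℝ≥0∞) ∂P ≤ v := by
  -- Telescoped drift: the accumulated decrease plus the remaining potential, which is nonnegative
  -- and dropped at the end, is at most `v`.
  have hind : ∀ N : ℕ, c * ∑ n ∈ Finset.range N, P {ω | (n : ℕ∞) < T ω}
      + ∫⁻ ω in {ω | (N : ℕ∞) < T ω}, V N ω ∂P ≤ v := by
    intro N
    induction N with
    | zero =>
      rw [Finset.range_zero, Finset.sum_empty, mul_zero, zero_add]
      calc _ ≤ ∫⁻ ω, V 0 ω ∂P := setLIntegral_le_lintegral _ _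
        _ ≤ ∫⁻ ω, v ∂P := lintegral_mono h0
        _ = v := by simp
    | succ N ih =>
      refine le_trans ?_ ih
      rw [Finset.sum_range_succ, mul_add, add_assoc]
      refine add_le_add le_rfl (le_trans ?_ (hstep N))
      rw [lintegral_add_right _ measurable_const, setLIntegral_const, add_comm]
      refine add_le_add (lintegral_mono_set fun ω hω => ?_) le_rfl
      exact lt_of_le_of_lt (by exact_mod_cast N.le_succ) (show ((N + 1 : ℕ) : ℕ∞) < T ω from hω)
  have hsum : ∫⁻ ω, (T ω : ℝ≥0∞) ∂P = ∑' n : ℕ, P {ω | (n : ℕ∞) < T ω} := by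
    simp only [ENat.toENNReal_eq_tsum]
    rw [lintegral_tsum fun n => (Measurable.ite (hT n) measurable_const measurable_const).aemeasurable]
    congr 1
    ext n
    rw [← lintegral_indicator_one (hT n)]
    exact lintegral_congr fun ω => by simp [Set.indicator_apply]
  rw [hsum, ENNReal.tsum_eq_iSup_nat, ENNReal.mul_iSup]
  exact iSup_le fun N => le_self_add.trans (hind N)

/-- What happens from time `m` on is independent of the first `k ≤ m` values. -/
theorem map_shift_restrict_infinitePi {α : Type*} [MeasurableSpace α]
    [MeasurableSingletonClass α] {μ : ℕ → Measure α} [∀ k, IsProbabilityMeasure (μ k)]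
    (y : ℕ → α) {k m : ℕ} (hkm : k ≤ m) :
    ((Measure.infinitePi μ).restrict {ω | ∀ i < k, ω i = y i}).map (fun ω i => ω (i + m))
      = Measure.infinitePi μ {ω | ∀ i < k, ω i = y i} •
        Measure.infinitePi (fun i => μ (i + m)) := by
  classical
  set P := Measure.infinitePi μ
  set C := {ω : ℕ → α | ∀ i < k, ω i = y i} with hC
  by_cases h0 : P C = 0
  · rw [Measure.restrict_eq_zero.mpr h0, h0, Measure.map_zero, zero_smul]
  have htop : P C ≠ ∞ := measure_ne_top _ _
  -- After normalization, the infinite product measure is recognized by its values on cylinders.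
  suffices h : (P C)⁻¹ • (P.restrict C).map (fun ω i => ω (i + m))
      = Measure.infinitePi (fun i => μ (i + m)) by
    rw [← h, smul_smul, ENNReal.mul_inv_cancel h0 htop, one_smul]
  refine Measure.eq_infinitePi _ fun s t ht => ?_
  have hms : MeasurableSet ((s : Set ℕ).pi t) :=
    MeasurableSet.pi s.countable_toSet fun i _ => ht i
  rw [Measure.smul_apply, Measure.map_apply (measurable_shift m) hms,
    Measure.restrict_apply (measurable_shift m hms), smul_eq_mul]
  set t' : ℕ → Set α := fun i => if i < k then {y i} else t (i - m) with ht'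
  have hset : (fun (ω : ℕ → α) i => ω (i + m)) ⁻¹' ((s : Set ℕ).pi t) ∩ C
      = ((Finset.range k ∪ s.map (addRightEmbedding m) : Finset ℕ) : Set ℕ).pi t' := by
    ext ω
    simp only [Set.mem_inter_iff, Set.mem_preimage, Set.mem_pi, hC, Set.mem_ofPred_eq,
      Finset.coe_union, Set.mem_union, Finset.mem_coe, Finset.mem_range, Finset.mem_map,
      addRightEmbedding_apply, ht']
    constructor
    · rintro ⟨h1, h2⟩ i (hi | ⟨j, hj, rfl⟩)
      · simpa [hi] using h2 i hi
      · rw [if_neg (by omega), Nat.add_sub_cancel]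
        exact h1 j hj
    · intro h
      refine ⟨fun j hj => ?_, fun i hi => by simpa [hi] using h i (Or.inl hi)⟩
      have := h (j + m) (Or.inr ⟨j, hj, rfl⟩)
      rwa [if_neg (by omega), Nat.add_sub_cancel] at this
  have hCset : C = ((Finset.range k : Finset ℕ) : Set ℕ).pi fun i => {y i} := by
    ext ω; simp [hC]
  have hdisj : Disjoint (Finset.range k) (s.map (addRightEmbedding m)) := by
    rw [Finset.disjoint_left]
    intro i hi hi2
    obtain ⟨j, -, rfl⟩ := Finset.mem_map.mp hi2
    have h3 := Finset.mem_range.mp hi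
    rw [addRightEmbedding_apply] at h3
    omega
  have hPC : P C = ∏ i ∈ Finset.range k, μ i {y i} := by
    rw [hCset, Measure.infinitePi_pi _ fun i _ => measurableSet_singleton _]
  rw [hset, Measure.infinitePi_pi, Finset.prod_union hdisj, Finset.prod_map]
  · have h1 : ∏ i ∈ Finset.range k, μ i (t' i) = P C := by
      rw [hPC]
      exact Finset.prod_congr rfl fun i hi => by simp [ht', Finset.mem_range.mp hi]
    rw [h1, ← mul_assoc, ENNReal.inv_mul_cancel h0 htop, one_mul]
    refine Finset.prod_congr rfl fun i _ => ?_
    simp only [ht', addRightEmbedding_apply]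
    rw [if_neg (by omega), Nat.add_sub_cancel]
  · intro i _
    simp only [ht']
    split_ifs
    exacts [measurableSet_singleton _, ht _]

section Sequences

variable {α : Type*} [Fintype α] [MeasurableSpace α] [MeasurableSingletonClass α]
  {μ : ℕ → Measure α} [∀ k, IsProbabilityMeasure (μ k)]

theorem DependsOn.measurable_of_range {β : Type*} [MeasurableSpace β] [Nonempty β]
    {f : (ℕ → α) → β} {n : ℕ} (hf : DependsOn f (Finset.range n)) : Measurable f := by
  obtain ⟨g, rfl⟩ := dependsOn_iff_exists_comp.mp hf
  exact (measurable_of_finite g).comp (measurable_domRestrict_range n)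

theorem lintegral_dependsOn_mul {f : (ℕ → α) → ℝ≥0∞} {n : ℕ}
    (hf : DependsOn f (Finset.range n)) (g : α → ℝ≥0∞) :
    ∫⁻ ω, f ω * g (ω n) ∂Measure.infinitePi μ
      = (∫⁻ ω, f ω ∂Measure.infinitePi μ) * ∫⁻ x, g x ∂μ n := by
  have hm := hf.measurable_of_range
  obtain ⟨F, rfl⟩ := dependsOn_iff_exists_comp.mp hf
  have hind := (iIndepFun_infinitePi (P := μ) (X := fun _ => id) fun _ => measurable_id)
    |>.indepFun_finset (Finset.range n) {n} (by simp) fun i => measurable_pi_apply i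
  have hind2 : (F ∘ Set.domRestrict (Finset.range n : Set ℕ)) ⟂ᵢ[Measure.infinitePi μ]
      (fun ω : ℕ → α => g (ω n)) := hind.comp (φ := F) (ψ := fun z : ((({n} : Finset ℕ)) → α) => g (z ⟨n, by simp⟩))
    (measurable_of_finite _) (measurable_of_finite _)
  have h := lintegral_mul_eq_lintegral_mul_lintegral_of_indepFun hm
    (g := fun ω : ℕ → α => g (ω n)) ((measurable_of_finite g).comp (measurable_pi_apply n)) hind2
  refine h.trans ?_
  congr 1
  rw [← Measure.infinitePi_map_eval μ n, lintegral_map (measurable_of_finite g)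
    (measurable_pi_apply n)]

/-- Conditioning on the first `n` values. -/
theorem lintegral_apply_eval {G : (ℕ → α) → α → ℝ≥0∞} {n : ℕ}
    (hG : ∀ x, DependsOn (fun ω => G ω x) (Finset.range n)) :
    ∫⁻ ω, G ω (ω n) ∂Measure.infinitePi μ
      = ∫⁻ ω, ∑ x, μ n {x} * G ω x ∂Measure.infinitePi μ := by
  classical
  have h1 : ∀ ω : ℕ → α, G ω (ω n) = ∑ x, G ω x * Set.indicator {x} 1 (ω n) := fun ω => by
    rw [Finset.sum_eq_single (ω n)]
    · simp
    · intro x _ hx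
      simp [Ne.symm hx]
    · simp
  simp only [h1]
  have hmeas : ∀ x, Measurable fun ω => G ω x := fun x => (hG x).measurable_of_range
  have hmeas2 : ∀ x, Measurable fun ω : ℕ → α => G ω x * Set.indicator {x} 1 (ω n) := fun x =>
    (hmeas x).mul ((measurable_of_finite (Set.indicator {x} 1)).comp (measurable_pi_apply n))
  rw [lintegral_finsetSum _ fun x _ => hmeas2 x,
    lintegral_finsetSum _ fun x _ => (hmeas x).const_mul _]
  refine Finset.sum_congr rfl fun x _ => ?_
  rw [lintegral_dependsOn_mul (hG x), lintegral_const_mul _ (hmeas x),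
    lintegral_indicator_one (measurableSet_singleton x), mul_comm]

end Sequences

/-! ### Stopping times of the test -/

section Qusum

variable {d l : ℕ} (b : BlockPVM d l) (ρ : QState d)

/-- The likelihood ratio of a block outcome. -/
noncomputable def likRatio (σ : QState d) (x : Fin (d ^ l)) : ℝ≥0∞ :=
  blockPMF b (fun _ => σ) x / blockPMF b (fun _ => ρ) x

theorem ENNReal.log_prod_eq_sum {ι : Type*} (s : Finset ι) (f : ι → ℝ≥0∞) :
    ENNReal.log (∏ i ∈ s, f i) = ∑ i ∈ s, ENNReal.log (f i) := by
  classical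
  induction s using Finset.induction_on with
  | empty => simp
  | insert a s ha ih => rw [Finset.prod_insert ha, Finset.sum_insert ha, ENNReal.log_mul_add, ih]

/-- Products in `ℝ≥0∞` replace sums in `EReal`: the conventions `0 * ∞ = 0` and `⊥ + ⊤ = ⊥` match
under `ENNReal.log`. -/
theorem le_glr_iff {S : Finset (QState d)} {h : ℝ} {ω : ℕ → Fin (d ^ l)} {j n : ℕ} :
    (h : EReal) ≤ glr b ρ S ω j n ↔
      ∃ σ ∈ S, ENNReal.ofReal (Real.exp h) ≤ ∏ i ∈ Finset.Ico j n, likRatio b ρ σ (ω i) := by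
  rw [glr, ← Finset.sup_eq_iSup, Finset.le_sup_iff (EReal.bot_lt_coe h)]
  refine exists_congr fun σ => and_congr_right fun _ => ?_
  have h1 : (h : EReal) = ENNReal.log (ENNReal.ofReal (Real.exp h)) := by
    rw [ENNReal.log_ofReal_of_pos (Real.exp_pos h), Real.log_exp]
  rw [h1, ← ENNReal.log_le_log_iff, ENNReal.log_prod_eq_sum]
  rfl

variable (S : Finset (QState d)) (h : ℝ)

theorem stopFrom_le_iff {j n : ℕ} {ω : ℕ → Fin (d ^ l)} :
    stopFrom b ρ S h j ω ≤ n ↔ ∃ m ≤ n, j < m ∧ (h : EReal) ≤ glr b ρ S ω j m := by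
  rw [← ENat.lt_add_one_iff (ENat.natCast_ne_top n), stopFrom]
  simp only [iInf_lt_iff]
  simp only [ENat.lt_add_one_iff (ENat.natCast_ne_top n), Nat.cast_le]
  constructor
  · rintro ⟨m, hm, hmn⟩; exact ⟨m, hmn, hm⟩
  · rintro ⟨m, hmn, hm⟩; exact ⟨m, hm, hmn⟩

theorem qusum_le_iff {n : ℕ} {ω : ℕ → Fin (d ^ l)} :
    qusum b ρ S h ω ≤ n ↔ ∃ m ≤ n, ∃ j < m, (h : EReal) ≤ glr b ρ S ω j m := by
  rw [← ENat.lt_add_one_iff (ENat.natCast_ne_top n), qusum, iInf_lt_iff]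
  simp only [ENat.lt_add_one_iff (ENat.natCast_ne_top n), stopFrom_le_iff]
  constructor
  · rintro ⟨j, m, hmn, hj, hm⟩; exact ⟨m, hmn, j, hj, hm⟩
  · rintro ⟨m, hmn, j, hj, hm⟩; exact ⟨j, m, hmn, hj, hm⟩

theorem glr_congr {ω ω' : ℕ → Fin (d ^ l)} {j n : ℕ} (hω : ∀ i < n, ω i = ω' i) :
    glr b ρ S ω j n = glr b ρ S ω' j n := by
  unfold glr
  refine iSup_congr fun σ => iSup_congr fun _ => Finset.sum_congr rfl fun i hi => ?_
  rw [hω i (Finset.mem_Ico.mp hi).2]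

theorem qusum_le_congr {ω ω' : ℕ → Fin (d ^ l)} {n : ℕ} (hω : ∀ i < n, ω i = ω' i) :
    qusum b ρ S h ω ≤ n ↔ qusum b ρ S h ω' ≤ n := by
  rw [qusum_le_iff, qusum_le_iff]
  exact exists_congr fun m => and_congr_right fun hm => exists_congr fun j =>
    and_congr_right fun _ => by rw [glr_congr b ρ S fun i hi => hω i (hi.trans_le hm)]

theorem stopFrom_le_congr {ω ω' : ℕ → Fin (d ^ l)} {j n : ℕ} (hω : ∀ i < n, ω i = ω' i) :
    stopFrom b ρ S h j ω ≤ n ↔ stopFrom b ρ S h j ω' ≤ n := by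
  rw [stopFrom_le_iff, stopFrom_le_iff]
  exact exists_congr fun m => and_congr_right fun hm =>
    and_congr_right fun _ => by rw [glr_congr b ρ S fun i hi => hω i (hi.trans_le hm)]

/-- The stopping time property: the first `n` outcomes decide whether the alarm comes within `n`
blocks. -/
theorem dependsOn_lt_qusum (n : ℕ) :
    DependsOn (fun ω => (n : ℕ∞) < qusum b ρ S h ω) (Finset.range n) := by
  intro ω ω' hω
  simp only [← not_le]
  rw [qusum_le_congr b ρ S h fun i hi => hω i (by simpa using hi)]

theorem dependsOn_lt_stopFrom (j n : ℕ) :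
    DependsOn (fun ω => (n : ℕ∞) < stopFrom b ρ S h j ω) (Finset.range n) := by
  intro ω ω' hω
  simp only [← not_le]
  rw [stopFrom_le_congr b ρ S h fun i hi => hω i (by simpa using hi)]

theorem measurableSet_lt_qusum (n : ℕ) :
    MeasurableSet {ω | (n : ℕ∞) < qusum b ρ S h ω} :=
  measurableSet_setOfPred.mpr (dependsOn_lt_qusum b ρ S h n).measurable_of_range

theorem measurableSet_lt_stopFrom (j n : ℕ) :
    MeasurableSet {ω | (n : ℕ∞) < stopFrom b ρ S h j ω} :=
  measurableSet_setOfPred.mpr (dependsOn_lt_stopFrom b ρ S h j n).measurable_of_range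

theorem measurable_toENNReal {Ω : Type*} [MeasurableSpace Ω] {T : Ω → ℕ∞}
    (hT : ∀ n : ℕ, MeasurableSet {ω | (n : ℕ∞) < T ω}) : Measurable fun ω => (T ω : ℝ≥0∞) := by
  simp only [ENat.toENNReal_eq_tsum]
  exact Measurable.tsum fun n => Measurable.ite (hT n) measurable_const measurable_const

/-- The Shiryaev–Roberts statistic. -/
noncomputable def shiryaevRoberts (σ : QState d) : ℕ → (ℕ → Fin (d ^ l)) → ℝ≥0∞
  | 0, _ => 0
  | n + 1, ω => (1 + shiryaevRoberts σ n ω) * likRatio b ρ σ (ω n)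

/-- Unfolding the recursion, the statistic is the sum of these products over all `j < n`. -/
theorem prod_likRatio_le_shiryaevRoberts (σ : QState d) (ω : ℕ → Fin (d ^ l)) {j n : ℕ}
    (hj : j < n) : ∏ i ∈ Finset.Ico j n, likRatio b ρ σ (ω i) ≤ shiryaevRoberts b ρ σ n ω := by
  induction n with
  | zero => omega
  | succ n ih =>
    rw [Finset.prod_Ico_succ_top (Nat.lt_succ_iff.mp hj), shiryaevRoberts]
    gcongr
    rcases (Nat.lt_succ_iff.mp hj).eq_or_lt with rfl | hlt
    · simp
    · exact (ih hlt).trans le_add_self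

theorem dependsOn_shiryaevRoberts (σ : QState d) (n : ℕ) :
    DependsOn (shiryaevRoberts b ρ σ n) (Finset.range n) := by
  induction n with
  | zero => intro ω ω' _; rfl
  | succ n ih =>
    intro ω ω' hω
    rw [shiryaevRoberts, shiryaevRoberts, hω n (by simp), ih fun i hi => hω i ?_]
    simp only [Finset.coe_range, Set.mem_Iio] at hi ⊢
    omega

/-- An outcome impossible under `ρ` contributes `0` on the left, whatever its mass under `σ`; hence
only an inequality. -/
theorem sum_blockPMF_mul_likRatio_le (σ : QState d) :
    ∑ x, blockPMF b (fun _ => ρ) x * likRatio b ρ σ x ≤ 1 := by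
  calc _ ≤ ∑ x, blockPMF b (fun _ => σ) x := Finset.sum_le_sum fun x _ => ENNReal.mul_div_le
    _ = 1 := by rw [← tsum_fintype (L := .unconditional _), PMF.tsum_coe]

theorem sum_blockPMF (s : Fin l → QState d) : ∑ x, blockPMF b s x = 1 := by
  rw [← tsum_fintype (L := .unconditional _), PMF.tsum_coe]

instance (s : ℕ → QState d) : IsProbabilityMeasure (pathLaw b s) := by
  unfold pathLaw; infer_instance

open Classical in
/-- The mean of the Shiryaev–Roberts process stopped at the alarm, with the value `exp h` there. -/
theorem lintegral_stopped_le (n : ℕ) :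
    ∫⁻ ω, (if (n : ℕ∞) < qusum b ρ S h ω then ∑ σ ∈ S, shiryaevRoberts b ρ σ n ω
        else ENNReal.ofReal (Real.exp h)) ∂pathLaw b (fun _ => ρ)
      ≤ S.card * ∑ k ∈ Finset.range n, pathLaw b (fun _ => ρ) {ω | (k : ℕ∞) < qusum b ρ S h ω} := by
  set P := pathLaw b (fun _ => ρ)
  set K := ENNReal.ofReal (Real.exp h)
  induction n with
  | zero =>
    have hpos : ∀ ω, ((0 : ℕ) : ℕ∞) < qusum b ρ S h ω := fun ω => by
      rw [← not_le, qusum_le_iff]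
      rintro ⟨m, hm, j, hj, -⟩
      omega
    simp only [hpos, if_true, shiryaevRoberts, Finset.sum_const_zero, lintegral_zero, zero_le]
  | succ n ih =>
    -- One update with the next outcome `x` kept as a variable, so that one can condition on the
    -- first `n` outcomes.
    set G : (ℕ → Fin (d ^ l)) → Fin (d ^ l) → ℝ≥0∞ := fun ω x =>
      if (n : ℕ∞) < qusum b ρ S h ω then
        ∑ σ ∈ S, (1 + shiryaevRoberts b ρ σ n ω) * likRatio b ρ σ x else K with hG
    have hGdep : ∀ x, DependsOn (fun ω => G ω x) (Finset.range n) := fun x ω ω' hω => by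
      simp only [hG]
      have h1 := dependsOn_lt_qusum b ρ S h n hω
      simp only at h1
      simp only [h1, fun σ => dependsOn_shiryaevRoberts b ρ σ n hω]
    calc _ ≤ ∫⁻ ω, G ω (ω n) ∂P := by
          refine lintegral_mono fun ω => ?_
          by_cases h1 : ((n + 1 : ℕ) : ℕ∞) < qusum b ρ S h ω
          · have h2 : (n : ℕ∞) < qusum b ρ S h ω :=
              lt_of_le_of_lt (by exact_mod_cast n.le_succ) h1
            simp only [hG, if_pos h1, if_pos h2]
            exact le_rfl
          · simp only [hG, if_neg h1]
            split_ifs with h2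
            -- The alarm comes exactly at block `n + 1`, so some product, and with it the statistic,
            -- has reached `exp h`.
            · obtain ⟨m, hm, j, hj, hjm⟩ := (qusum_le_iff b ρ S h).mp (not_lt.mp h1)
              have hmn : m = n + 1 := by
                by_contra hne
                exact absurd h2 (not_lt.mpr ((qusum_le_iff b ρ S h).mpr
                  ⟨m, by omega, j, hj, hjm⟩))
              subst hmn
              obtain ⟨σ, hσ, hK⟩ := (le_glr_iff b ρ).mp hjm
              refine hK.trans ((prod_likRatio_le_shiryaevRoberts b ρ σ ω hj).trans ?_)
              exact Finset.single_le_sum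
                (f := fun σ => (1 + shiryaevRoberts b ρ σ n ω) * likRatio b ρ σ (ω n))
                (fun _ _ => zero_le) hσ
            · exact le_rfl
      _ = ∫⁻ ω, ∑ x, (blockPMF b (fun _ => ρ)).toMeasure {x} * G ω x ∂P :=
          lintegral_apply_eval hGdep
      _ ≤ ∫⁻ ω, ((if (n : ℕ∞) < qusum b ρ S h ω then ∑ σ ∈ S, shiryaevRoberts b ρ σ n ω else K)
            + S.card * Set.indicator {ω | (n : ℕ∞) < qusum b ρ S h ω} 1 ω) ∂P := by
          refine lintegral_mono fun ω => ?_
          simp only [PMF.toMeasure_apply_singleton _ _ (measurableSet_singleton _), hG,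
            Set.indicator_apply, Set.mem_ofPred_eq]
          split_ifs with h1
          · simp only [Finset.mul_sum]
            rw [Finset.sum_comm, Pi.one_apply, mul_one, add_comm, ← nsmul_one S.card,
              ← Finset.sum_const, ← Finset.sum_add_distrib]
            refine Finset.sum_le_sum fun σ _ => ?_
            simp only [mul_left_comm _ (1 + shiryaevRoberts b ρ σ n ω)]
            rw [← Finset.mul_sum]
            exact mul_le_of_le_one_right' (sum_blockPMF_mul_likRatio_le b ρ σ)
          · rw [← Finset.sum_mul, sum_blockPMF]
            simp
      _ ≤ _ := by
          rw [lintegral_add_right _ ((measurable_one.indicator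
              (measurableSet_lt_qusum b ρ S h n)).const_mul _),
            lintegral_const_mul _ (measurable_one.indicator (measurableSet_lt_qusum b ρ S h n)),
            lintegral_indicator_one (measurableSet_lt_qusum b ρ S h n),
            Finset.sum_range_succ, mul_add]
          exact add_le_add ih le_rfl

/-- The stopped process gives `exp h * P(T* ≤ n) ≤ |S| E[T*]`, and `P(T* ≤ n) → 1` if `E[T*]` is
finite. -/
theorem exp_le_card_mul_lintegral_qusum (hS : S.Nonempty) :
    ENNReal.ofReal (Real.exp h)
      ≤ S.card * ∫⁻ ω, (qusum b ρ S h ω : ℝ≥0∞) ∂pathLaw b (fun _ => ρ) := by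
  classical
  set P := pathLaw b (fun _ => ρ)
  set K := ENNReal.ofReal (Real.exp h)
  set E := ∫⁻ ω, (qusum b ρ S h ω : ℝ≥0∞) ∂P
  have hmeas := measurable_toENNReal (measurableSet_lt_qusum b ρ S h)
  by_cases hE : E = ∞
  · rw [hE, ENNReal.mul_top (by simpa using hS.ne_empty)]
    exact le_top
  have hbound : ∀ n : ℕ, K * P {ω | qusum b ρ S h ω ≤ n} ≤ S.card * E := by
    intro n
    have hset : {ω | qusum b ρ S h ω ≤ n} = {ω | (n : ℕ∞) < qusum b ρ S h ω}ᶜ := by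
      ext ω; simp
    have hms : MeasurableSet {ω | qusum b ρ S h ω ≤ n} :=
      hset ▸ (measurableSet_lt_qusum b ρ S h n).compl
    calc K * P {ω | qusum b ρ S h ω ≤ n}
        = ∫⁻ ω, Set.indicator {ω | qusum b ρ S h ω ≤ n} (fun _ => K) ω ∂P := by
          rw [lintegral_indicator_const hms]
      _ ≤ _ := lintegral_mono fun ω => by
          by_cases h1 : (n : ℕ∞) < qusum b ρ S h ω
          · rw [Set.indicator_of_notMem (by simpa using h1)]
            exact zero_le
          · rw [if_neg h1]
            exact Set.indicator_le_self _ _ _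
      _ ≤ S.card * ∑ k ∈ Finset.range n, P {ω | (k : ℕ∞) < qusum b ρ S h ω} :=
          lintegral_stopped_le b ρ S h n
      _ ≤ S.card * E := by
          gcongr
          have h2 : ∀ k : ℕ, P {ω | (k : ℕ∞) < qusum b ρ S h ω}
              = ∫⁻ ω, (if (k : ℕ∞) < qusum b ρ S h ω then 1 else 0) ∂P := fun k => by
            rw [← lintegral_indicator_one (measurableSet_lt_qusum b ρ S h k)]
            exact lintegral_congr fun ω => by simp [Set.indicator_apply]
          simp only [h2]
          rw [← lintegral_finsetSum _ fun k _ => Measurable.ite (measurableSet_lt_qusum b ρ S h k)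
            measurable_const measurable_const]
          refine lintegral_mono fun ω => ?_
          rw [ENat.toENNReal_eq_tsum]
          exact ENNReal.sum_le_tsum _
  have hmono : Monotone fun n : ℕ => {ω | qusum b ρ S h ω ≤ n} := fun m n hmn ω hω =>
    le_trans (show qusum b ρ S h ω ≤ m from hω) (by exact_mod_cast hmn)
  have hunion : P (⋃ n : ℕ, {ω | qusum b ρ S h ω ≤ n}) = 1 := by
    refine le_antisymm prob_le_one ?_
    rw [← measure_univ (μ := P)]
    refine measure_mono_ae ?_
    filter_upwards [ae_lt_top hmeas hE] with ω hω _
    obtain ⟨n, hn⟩ := ENat.ne_top_iff_exists.mp (ENat.toENNReal_lt_top.mp hω).ne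
    exact Set.mem_iUnion.mpr ⟨n, hn.ge⟩
  calc K = K * P (⋃ n : ℕ, {ω | qusum b ρ S h ω ≤ n}) := by rw [hunion, mul_one]
    _ = ⨆ n : ℕ, K * P {ω | qusum b ρ S h ω ≤ n} := by
        rw [hmono.measure_iUnion, ENNReal.mul_iSup]
    _ ≤ _ := iSup_le hbound

theorem le_meanFalseAlarm (hS : S.Nonempty) :
    ENNReal.ofReal (l * Real.exp h / S.card) ≤ meanFalseAlarm b ρ S h := by
  have hcard : (S.card : ℝ≥0∞) ≠ 0 := by simpa using hS.ne_empty
  have h1 := exp_le_card_mul_lintegral_qusum b ρ S h hS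
  rw [meanFalseAlarm]
  simp only [alarmTime, ENat.toENNReal_mul, ENat.toENNReal_coe]
  rw [lintegral_const_mul _ (measurable_toENNReal (measurableSet_lt_qusum b ρ S h)),
    ENNReal.ofReal_div_of_pos (by exact_mod_cast hS.card_pos), ENNReal.ofReal_mul (by positivity),
    ENNReal.ofReal_natCast, ENNReal.ofReal_natCast, mul_div_assoc]
  gcongr
  exact ENNReal.div_le_of_le_mul' h1

end Qusum

/-! ### Detection delay -/

section Delay

variable {d l : ℕ} (b : BlockPVM d l) (ρ : QState d) (S : Finset (QState d)) (h : ℝ)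

theorem glr_shift (ω : ℕ → Fin (d ^ l)) (m n : ℕ) :
    glr b ρ S (fun i => ω (i + m)) 0 n = glr b ρ S ω m (n + m) := by
  unfold glr
  refine iSup_congr fun σ => iSup_congr fun _ => ?_
  rw [Finset.sum_Ico_add' (fun i => logLR b ρ σ (ω i)), zero_add]

theorem stopFrom_le_shift (ω : ℕ → Fin (d ^ l)) (m : ℕ) :
    stopFrom b ρ S h m ω ≤ m + stopFrom b ρ S h 0 (fun i => ω (i + m)) := by
  by_cases htop : stopFrom b ρ S h 0 (fun i => ω (i + m)) = ⊤
  · rw [htop, add_top]; exact le_top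
  obtain ⟨n, hn⟩ := ENat.ne_top_iff_exists.mp htop
  rw [← hn]
  obtain ⟨n', hn', hpos, hle⟩ := (stopFrom_le_iff b ρ S h).mp hn.ge
  rw [← Nat.cast_add, stopFrom_le_iff]
  exact ⟨n' + m, by omega, by omega, by rwa [glr_shift] at hle⟩

/-- Alarms occur only at block ends, so survival up to `ν` concerns completed blocks only. -/
theorem lt_alarmTime_iff (hl : 0 < l) (ν : ℕ) (ω : ℕ → Fin (d ^ l)) :
    (ν : ℕ∞) < alarmTime b ρ S h ω ↔ ((ν / l : ℕ) : ℕ∞) < qusum b ρ S h ω := by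
  rw [alarmTime]
  induction qusum b ρ S h ω using ENat.recTopCoe with
  | top => simp [ENat.mul_top, hl.ne']
  | coe n =>
    norm_cast
    rw [Nat.div_lt_iff_lt_mul hl, mul_comm]

theorem worstDelay_le (σ : QState d) :
    worstDelay b ρ S h σ ≤
      l * (1 + ∫⁻ ω, (stopFrom b ρ S h 0 ω : ℝ≥0∞) ∂pathLaw b (fun _ => σ)) := by
  refine iSup_le fun ν => iSup_le fun y => iSup_le fun _ => ?_
  rcases l.eq_zero_or_pos with rfl | hl
  · simp only [alarmTime, Nat.cast_zero, zero_mul, zero_tsub, ENat.toENNReal_zero, lintegral_zero,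
      zero_le]
  set P := pathLaw b (changePoint ρ σ ν)
  set k := ν / l with hk
  have hνk : l * k ≤ ν := Nat.mul_div_le ν l
  have hνk' : ν < (k + 1) * l := (Nat.div_lt_iff_lt_mul hl).mp (Nat.lt_succ_self _)
  -- The record decides whether `T > ν`, so the conditioning event is either empty or the whole
  -- record.
  have hev : ∀ ω ∈ record l ν y,
      ((ν : ℕ∞) < alarmTime b ρ S h ω ↔ ((k : ℕ) : ℕ∞) < qusum b ρ S h y) := fun ω hω => by
    rw [lt_alarmTime_iff b ρ S h hl, ← not_le, ← not_le, qusum_le_congr b ρ S h hω]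
  by_cases hy : ((k : ℕ) : ℕ∞) < qusum b ρ S h y
  swap
  · have hempty : {ω | (ν : ℕ∞) < alarmTime b ρ S h ω} ∩ record l ν y = ∅ := by
      ext ω
      simp only [Set.mem_inter_iff, Set.mem_ofPred_eq, Set.mem_empty_iff_false, iff_false]
      exact fun hω => hy ((hev ω hω.2).mp hω.1)
    simp [hempty]
  have hrec : {ω | (ν : ℕ∞) < alarmTime b ρ S h ω} ∩ record l ν y = record l ν y :=
    Set.inter_eq_right.mpr fun ω hω => (hev ω hω).mpr hy
  rw [hrec]
  set f : (ℕ → Fin (d ^ l)) → ℝ≥0∞ := fun ω => l * (1 + (stopFrom b ρ S h 0 ω : ℝ≥0∞)) with hf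
  have hT := measurable_toENNReal (measurableSet_lt_stopFrom b ρ S h 0)
  have hfm : Measurable f := (hT.const_add 1).const_mul _
  -- The change occurs no later than in block `k`, counted from zero; from block `k + 1` on all
  -- systems are in the state `σ`.
  have hlaw : (fun i => (blockPMF b fun t : Fin l =>
      changePoint ρ σ ν ((i + (k + 1)) * l + t)).toMeasure)
      = fun _ => (blockPMF b fun _ => σ).toMeasure := by
    funext i
    congr 2
    funext t
    rw [changePoint, if_neg]
    have : (k + 1) * l ≤ (i + (k + 1)) * l := Nat.mul_le_mul_right l (by omega)
    omega
  have hmap := map_shift_restrict_infinitePi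
    (μ := fun k => (blockPMF b fun t : Fin l => changePoint ρ σ ν (k * l + t)).toMeasure) y
    (k.le_succ)
  calc ∫⁻ ω, ((alarmTime b ρ S h ω - ν : ℕ∞) : ℝ≥0∞) ∂P[|record l ν y]
      ≤ ∫⁻ ω, f (fun i => ω (i + (k + 1))) ∂P[|record l ν y] := by
        refine lintegral_mono fun ω => ?_
        have h1 : alarmTime b ρ S h ω - ν
            ≤ l * (1 + stopFrom b ρ S h 0 fun i => ω (i + (k + 1))) := by
          rw [tsub_le_iff_right]
          calc alarmTime b ρ S h ω
              ≤ l * (((k + 1 : ℕ) : ℕ∞) + stopFrom b ρ S h 0 fun i => ω (i + (k + 1))) :=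
                mul_le_mul_right ((iInf_le _ (k + 1)).trans (stopFrom_le_shift b ρ S h ω _)) _
            _ = l * (1 + stopFrom b ρ S h 0 fun i => ω (i + (k + 1))) + (l * k : ℕ) := by
                push_cast; ring
            _ ≤ _ := by gcongr
        have h2 := ENat.toENNReal_le.mpr h1
        simpa [hf] using h2
    _ = (P (record l ν y))⁻¹ * (P (record l ν y)
          * ∫⁻ ω, f ω ∂pathLaw b (fun _ => σ)) := by
        rw [ProbabilityTheory.cond, lintegral_smul_measure, smul_eq_mul,
          ← lintegral_map hfm (measurable_shift (k + 1))]
        congr 1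
        refine (congrArg (fun m => ∫⁻ ω, f ω ∂m) hmap).trans ?_
        rw [hlaw, lintegral_smul_measure]
        rfl
    _ ≤ ∫⁻ ω, f ω ∂pathLaw b (fun _ => σ) := by
        rw [← mul_assoc]
        exact mul_le_of_le_one_left' (ENNReal.inv_mul_le_one _)
    _ = _ := by
        rw [hf, lintegral_const_mul _ (hT.const_add 1), lintegral_add_right _ hT,
          lintegral_one, measure_univ]

variable {b ρ S h}

theorem born_le_one (s : Fin l → QState d) (x : Fin (d ^ l)) : born b s x ≤ 1 :=
  born_sum b s ▸ Finset.single_le_sum (fun x _ => born_nonneg b s x) (Finset.mem_univ x)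

/-- Wald's bound for the mean delay. -/
theorem mul_lintegral_stopFrom_le {σ τ : QState d} (hσS : σ ∈ S) (hρ : SuppLE τ ρ)
    (hσ : SuppLE τ σ) {c : ℝ} (hc : 0 ≤ c)
    (hcle : c ≤ ∑ x, born b (fun _ => τ) x *
      (Real.log (born b (fun _ => σ) x) - Real.log (born b (fun _ => ρ) x))) (hh : 0 ≤ h) :
    ENNReal.ofReal c * ∫⁻ ω, (stopFrom b ρ S h 0 ω : ℝ≥0∞) ∂pathLaw b (fun _ => τ)
      ≤ ENNReal.ofReal (h + ∑ x, |Real.log (born b (fun _ => ρ) x)|) := by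
  -- A bound for the overshoot: `Z x ≤ -log p(x) ≤ C`, because outcome probabilities are at most
  -- `1`.
  set C : ℝ := ∑ x, |Real.log (born b (fun _ => ρ) x)|
  set q : Fin (d ^ l) → ℝ := born b fun _ => τ with hq
  set Z : Fin (d ^ l) → ℝ := fun x =>
    Real.log (born b (fun _ => σ) x) - Real.log (born b (fun _ => ρ) x) with hZ
  set P := pathLaw b (fun _ => τ) with hP
  set s : ℕ → (ℕ → Fin (d ^ l)) → ℝ := fun n ω => ∑ i ∈ Finset.range n, Z (ω i) with hs
  have hZC : ∀ x, Z x ≤ C := fun x => by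
    have h1 := Real.log_nonpos (born_nonneg b (fun _ => σ) x) (born_le_one _ x)
    have h2 : |Real.log (born b (fun _ => ρ) x)| ≤ C :=
      Finset.single_le_sum (f := fun x => |Real.log (born b (fun _ => ρ) x)|)
        (fun x _ => abs_nonneg _) (Finset.mem_univ x)
    have h3 := neg_abs_le (Real.log (born b (fun _ => ρ) x))
    simp only [hZ]
    linarith
  have hLR : ∀ x, q x ≠ 0 → likRatio b ρ σ x = ENNReal.ofReal (Real.exp (Z x)) := fun x hx => by
    have h1 : 0 < born b (fun _ => σ) x :=
      (born_nonneg _ _ x).lt_of_ne fun h0 => hx (hσ.born_eq_zero b h0.symm)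
    have h2 : 0 < born b (fun _ => ρ) x :=
      (born_nonneg _ _ x).lt_of_ne fun h0 => hx (hρ.born_eq_zero b h0.symm)
    simp only [hZ]
    rw [likRatio, Real.exp_sub, Real.exp_log h1, Real.exp_log h2, ENNReal.ofReal_div_of_pos h2]
    rfl
  set A : ℕ → Set (ℕ → Fin (d ^ l)) := fun n => {ω | (n : ℕ∞) < stopFrom b ρ S h 0 ω} with hA
  -- Almost surely only outcomes with `q x ≠ 0` occur; on those the real-valued `Z` is the true
  -- log-likelihood ratio.
  set B : ℕ → Set (ℕ → Fin (d ^ l)) := fun n => {ω | ∀ i < n, q (ω i) ≠ 0} with hB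
  have hae : ∀ n, ∀ᵐ ω ∂P, ω ∈ B n := fun n => by
    have h1 : ∀ i, ∀ᵐ ω ∂P, q (ω i) ≠ 0 := fun i => by
      have h2 := Measure.infinitePi_map_eval
        (fun k : ℕ => (blockPMF b fun t : Fin l => (fun _ => τ) (k * l + t)).toMeasure) i
      have h3 : ∀ᵐ x ∂(blockPMF b fun t : Fin l => (fun _ => τ) (i * l + t)).toMeasure, q x ≠ 0 := by
        rw [ae_iff, PMF.toMeasure_apply_eq_zero_iff _ (Set.toFinite _).measurableSet,
          Set.disjoint_left]
        intro x hx hx0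
        rw [PMF.mem_support_iff] at hx
        refine hx ?_
        have : q x = 0 := by simpa using hx0
        change ENNReal.ofReal (q x) = 0
        rw [this, ENNReal.ofReal_zero]
      rw [← h2] at h3
      exact ae_of_ae_map (measurable_pi_apply i).aemeasurable h3
    exact ae_all_iff.mpr fun i => (h1 i).mono fun ω hω _ => hω
  -- Before stopping the sum is at most `h`, so the potential `h + C - s n` is at least `C` and
  -- stays nonnegative after one more step: `ENNReal.ofReal` truncates nothing. At `n = 0` no stop
  -- is possible, whence `0 ≤ h`.
  have hsle : ∀ n, ∀ ω ∈ A n ∩ B n, s n ω ≤ h := fun n ω hω => by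
    rcases n.eq_zero_or_pos with rfl | hn
    · simpa [hs] using hh
    by_contra hlt
    refine absurd hω.1 (not_lt.mpr ((stopFrom_le_iff b ρ S h).mpr
      ⟨n, le_rfl, hn, (le_glr_iff b ρ).mpr ⟨σ, hσS, ?_⟩⟩))
    rw [Nat.Ico_zero_eq_range, Finset.prod_congr rfl fun i hi =>
      hLR (ω i) (hω.2 i (Finset.mem_range.mp hi)),
      ← ENNReal.ofReal_prod_of_nonneg fun i _ => (Real.exp_pos _).le, ← Real.exp_sum]
    exact ENNReal.ofReal_le_ofReal (Real.exp_le_exp.mpr (not_le.mp hlt).le)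
  have hABdep : ∀ n, DependsOn (fun ω => ω ∈ A n ∩ B n) (Finset.range n) := fun n ω ω' hω => by
    have h1 := dependsOn_lt_stopFrom b ρ S h 0 n hω
    have h2 : (ω ∈ B n) = (ω' ∈ B n) := by
      refine propext (forall_congr' fun i => forall_congr' fun hi => ?_)
      rw [hω i (by simpa using hi)]
    exact congrArg₂ And h1 h2
  have hABmeas : ∀ n, MeasurableSet (A n ∩ B n) := fun n =>
    measurableSet_setOfPred.mpr (hABdep n).measurable_of_range
  have hABae : ∀ n, A n =ᵐ[P] (A n ∩ B n : Set _) := fun n => by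
    filter_upwards [hae n] with ω hω
    exact propext ⟨fun h1 => ⟨h1, hω⟩, fun h1 => h1.1⟩
  have hmean : ∀ v : ℝ, C ≤ v → ∑ x, (blockPMF b fun _ => τ).toMeasure {x}
      * (ENNReal.ofReal (v - Z x) + ENNReal.ofReal c) ≤ ENNReal.ofReal v := fun v hv => by
    have h1 : ∀ x, (blockPMF b fun _ => τ).toMeasure {x} * (ENNReal.ofReal (v - Z x)
        + ENNReal.ofReal c) = ENNReal.ofReal (q x * (v - Z x + c)) := fun x => by
      rw [PMF.toMeasure_apply_singleton _ _ (measurableSet_singleton _),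
        ← ENNReal.ofReal_add (sub_nonneg.mpr ((hZC x).trans hv)) hc,
        ENNReal.ofReal_mul (born_nonneg _ _ x)]
      rfl
    rw [Finset.sum_congr rfl fun x _ => h1 x, ← ENNReal.ofReal_sum_of_nonneg fun x _ =>
      mul_nonneg (born_nonneg _ _ x) (add_nonneg (sub_nonneg.mpr ((hZC x).trans hv)) hc)]
    refine ENNReal.ofReal_le_ofReal ?_
    have h2 : ∑ x, q x * (v - Z x + c) = (v + c) * ∑ x, q x - ∑ x, q x * Z x := by
      rw [Finset.mul_sum, ← Finset.sum_sub_distrib]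
      exact Finset.sum_congr rfl fun x _ => by ring
    rw [h2, hq, born_sum]
    linarith
  refine mul_lintegral_le_of_drift (V := fun n ω => ENNReal.ofReal (h + C - s n ω))
    (measurableSet_lt_stopFrom b ρ S h 0) (fun ω => by simp [hs]) fun n => ?_
  change ∫⁻ ω in A n, _ ∂P ≤ ∫⁻ ω in A n, _ ∂P
  rw [setLIntegral_congr (hABae n), setLIntegral_congr (hABae n),
    ← lintegral_indicator (hABmeas n), ← lintegral_indicator (hABmeas n)]
  have hsdep : DependsOn (s n) (Finset.range n) := fun ω ω' hω =>
    Finset.sum_congr rfl fun i hi => by rw [hω i hi]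
  set G : (ℕ → Fin (d ^ l)) → Fin (d ^ l) → ℝ≥0∞ := fun ω x => (A n ∩ B n).indicator
    (fun ω => ENNReal.ofReal (h + C - s n ω - Z x) + ENNReal.ofReal c) ω with hG
  have hGdep : ∀ x, DependsOn (fun ω => G ω x) (Finset.range n) := fun x ω ω' hω => by
    have h1 := hABdep n hω
    simp only at h1
    simp only [hG, Set.indicator_apply, h1, hsdep hω]
  calc _ = ∫⁻ ω, G ω (ω n) ∂P := by
        refine lintegral_congr fun ω => ?_
        simp only [hG, Set.indicator_apply, hs, Finset.sum_range_succ, sub_sub]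
    _ = ∫⁻ ω, ∑ x, (blockPMF b fun _ => τ).toMeasure {x} * G ω x ∂P := lintegral_apply_eval hGdep
    _ ≤ _ := lintegral_mono fun ω => by
        by_cases hω : ω ∈ A n ∩ B n
        · simp only [hG, Set.indicator_of_mem hω]
          exact hmean _ (by linarith [hsle n ω hω])
        · simp only [hG, Set.indicator_of_notMem hω, mul_zero, Finset.sum_const_zero, le_refl]

theorem worstDelay_le_ofReal {σ τ : QState d} (hσS : σ ∈ S) (hρ : SuppLE τ ρ)
    (hσ : SuppLE τ σ) {c : ℝ} (hc : 0 < c)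
    (hcle : c ≤ ∑ x, born b (fun _ => τ) x *
      (Real.log (born b (fun _ => σ) x) - Real.log (born b (fun _ => ρ) x))) (hh : 0 ≤ h) :
    worstDelay b ρ S h τ
      ≤ ENNReal.ofReal (l * (1 + (h + ∑ x, |Real.log (born b (fun _ => ρ) x)|) / c)) := by
  refine (worstDelay_le b ρ S h τ).trans ?_
  have hC : 0 ≤ ∑ x, |Real.log (born b (fun _ => ρ) x)| :=
    Finset.sum_nonneg fun x _ => abs_nonneg _
  have h1 := mul_lintegral_stopFrom_le hσS hρ hσ hc.le hcle hh
  rw [ENNReal.ofReal_mul (by positivity), ENNReal.ofReal_natCast,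
    ENNReal.ofReal_add zero_le_one (by positivity), ENNReal.ofReal_one,
    ENNReal.ofReal_div_of_pos hc]
  gcongr
  rw [ENNReal.le_div_iff_mul_le (Or.inl (by simpa using hc)) (Or.inl ENNReal.ofReal_ne_top),
    mul_comm]
  exact h1

end Delay

/-! ### Achievable rates -/

section Rate

variable {d : ℕ} {M : ∀ l, BlockPVM d l} {ρ : QState d} {S : Finset (QState d)}

/-- The linear functional `tr [τ (log σ - log ρ)]` of `τ`, which is `D(τ‖ρ) - D(τ‖σ)`. -/
noncomputable def meanLogRatio (ρ σ τ : QState d) : ℝ :=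
  (τ.mat * (cfc Real.log σ.mat - cfc Real.log ρ.mat)).trace.re

theorem SuppLE.refl (σ : QState d) : SuppLE σ σ := fun _ h => h

theorem relEntropy_eq_meanLogRatio {σ : QState d} (h : SuppLE σ ρ) :
    relEntropy σ ρ = (meanLogRatio ρ σ σ : EReal) :=
  if_pos h

theorem relEntropy_sub_relEntropy {σ τ : QState d} (hρ : SuppLE τ ρ) (hσ : SuppLE τ σ) :
    relEntropy τ ρ - relEntropy τ σ = (meanLogRatio ρ σ τ : EReal) := by
  rw [relEntropy_eq_meanLogRatio hρ, relEntropy_eq_meanLogRatio hσ, ← EReal.coe_sub]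
  congr 1
  simp only [meanLogRatio, Matrix.mul_sub, Matrix.trace_sub, Complex.sub_re]
  ring

/-- The supremum over the finite `S` is attained. A `σ` whose support is too small yields `⊥`, which
is excluded by `0 < I`. -/
theorem exists_le_meanLogRatio {τ : QState d} (hρ : SuppLE τ ρ) {I : EReal} (hI : 0 < I)
    (h : I ≤ ⨆ σ ∈ S, (relEntropy τ ρ - relEntropy τ σ)) :
    ∃ σ ∈ S, SuppLE τ σ ∧ I ≤ (meanLogRatio ρ σ τ : EReal) := by
  have hbot : ⊥ < I := EReal.bot_lt_zero.trans hI
  rw [← Finset.sup_eq_iSup, Finset.le_sup_iff hbot] at h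
  obtain ⟨σ, hσS, hσ⟩ := h
  by_cases hs : SuppLE τ σ
  · exact ⟨σ, hσS, hs, (relEntropy_sub_relEntropy hρ hs) ▸ hσ⟩
  · have h1 : relEntropy τ σ = ⊤ := if_neg hs
    rw [h1, EReal.sub_top] at hσ
    exact absurd hbot (not_lt.mpr hσ)

theorem eventually_log_le_mul (D : ℝ) {η : ℝ} (hη : 0 < η) :
    ∀ᶠ l : ℕ in atTop, D * Real.log (l + 1) ≤ η * l := by
  have h1 : Tendsto (fun l : ℕ => D * (Real.log ((l : ℝ) + 1) ^ 1 / (1 * ((l : ℝ) + 1) + -1)))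
      atTop (𝓝 (D * 0)) :=
    ((Real.tendsto_pow_log_div_mul_add_atTop 1 (-1) 1 one_ne_zero).comp
      (tendsto_atTop_add_const_right _ 1 tendsto_natCast_atTop_atTop)).const_mul D
  rw [mul_zero] at h1
  filter_upwards [h1.eventually_lt_const hη, eventually_gt_atTop 0] with l hl hl0
  have hl0' : (0 : ℝ) < l := by exact_mod_cast hl0
  rw [pow_one, one_mul, add_neg_cancel_right, mul_div_assoc', div_lt_iff₀ hl0'] at hl
  exact hl.le

/-- The delay over a family of states on which `max_σ (D(τ‖ρ) - D(τ‖σ))` is at least `J`. -/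
theorem eventually_familyDelay_le (hM : ∀ l, IsHayashiPVM ρ (M l)) {S' : Set (QState d)} {J : ℝ}
    (hJ : 0 < J) (hS' : ∀ τ ∈ S', SuppLE τ ρ ∧ ∃ σ ∈ S, SuppLE τ σ ∧ J ≤ meanLogRatio ρ σ τ)
    {ε : ℝ} (hε : 0 < ε) :
    ∀ᶠ l : ℕ in atTop, ∀ᶠ h : ℝ in atTop,
      familyDelay (M l) ρ S h S' ≤ ((h * (1 + ε) / J : ℝ) : EReal) := by
  -- This is `J - J / (1 + ε / 2)`, the loss per system for which `l * J ≤ (1 + ε / 2) * c` remains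
  -- true.
  have hη : 0 < ε / 2 * J / (1 + ε / 2) := by positivity
  filter_upwards [eventually_log_le_mul (d * d) hη, eventually_gt_atTop 0] with l hl hl0
  have hl0' : (0 : ℝ) < l := by exact_mod_cast hl0
  set c : ℝ := l * J - d * d * Real.log (l + 1) with hc
  set C : ℝ := ∑ x, |Real.log (born (M l) (fun _ => ρ) x)|
  have hC : 0 ≤ C := Finset.sum_nonneg fun x _ => abs_nonneg _
  have hlc : l * J ≤ (1 + ε / 2) * c := by
    have h1 : ε / 2 * J / (1 + ε / 2) * l * (1 + ε / 2) = ε / 2 * J * l := by field_simp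
    have h2 := mul_le_mul_of_nonneg_right hl (by positivity : (0 : ℝ) ≤ 1 + ε / 2)
    rw [hc]
    linarith
  have hcpos : 0 < c := by
    have h1 : 0 < (1 + ε / 2) * c := (mul_pos hl0' hJ).trans_le hlc
    exact (pos_iff_pos_of_mul_pos h1).mp (by positivity)
  -- The other `ε / 2` of the threshold absorbs the lost block and the overshoot.
  filter_upwards [eventually_ge_atTop 0,
    eventually_ge_atTop ((J * l + (1 + ε / 2) * C) / (ε / 2))] with h hh hlarge
  have hnum : l * (1 + (h + C) / c) ≤ h * (1 + ε) / J := by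
    have h1 : l / c ≤ (1 + ε / 2) / J := by
      rw [div_le_div_iff₀ hcpos hJ]
      exact hlc
    have h2 : l * (1 + (h + C) / c) = l + l / c * (h + C) := by ring
    have h3 := mul_le_mul_of_nonneg_right h1 (add_nonneg hh hC)
    rw [div_le_iff₀ (by positivity)] at hlarge
    rw [h2, le_div_iff₀ hJ]
    have h4 : (1 + ε / 2) / J * (h + C) * J = (1 + ε / 2) * (h + C) := by field_simp
    have h5 := mul_le_mul_of_nonneg_right h3 hJ.le
    linarith
  have hle : ⨆ τ ∈ S', worstDelay (M l) ρ S h τ ≤ ENNReal.ofReal (h * (1 + ε) / J) := by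
    refine iSup₂_le fun τ hτ => ?_
    obtain ⟨hρ, σ, hσS, hσ, hJσ⟩ := hS' τ hτ
    refine (worstDelay_le_ofReal hσS hρ hσ hcpos ?_ hh).trans (ENNReal.ofReal_le_ofReal hnum)
    refine le_trans ?_ ((hM l).le_sum_born_mul_log hρ hσ)
    exact sub_le_sub_right (mul_le_mul_of_nonneg_left hJσ hl0'.le) _
  refine (EReal.coe_ennreal_le_coe_ennreal_iff.mpr hle).trans_eq ?_
  rw [EReal.coe_ennreal_ofReal, max_eq_left (by positivity)]

theorem le_log_meanFalseAlarm (hS : S.Nonempty) {l : ℕ} (hl : S.card ≤ l) (h : ℝ) :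
    (h : EReal) ≤ ENNReal.log (meanFalseAlarm (M l) ρ S h) := by
  have h1 : ENNReal.ofReal (Real.exp h) ≤ meanFalseAlarm (M l) ρ S h := by
    refine le_trans (ENNReal.ofReal_le_ofReal ?_) (le_meanFalseAlarm (M l) ρ S h hS)
    have hcard : (0 : ℝ) < S.card := by exact_mod_cast hS.card_pos
    rw [le_div_iff₀ hcard, mul_comm]
    exact mul_le_mul_of_nonneg_right (by exact_mod_cast hl) (Real.exp_pos h).le
  have h2 := ENNReal.log_le_log h1
  rwa [ENNReal.log_ofReal_of_pos (Real.exp_pos h), Real.log_exp] at h2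

theorem ofReal_le_meanFalseAlarm (hS : S.Nonempty) {l : ℕ} (hl : 1 ≤ l) {γ : ℝ} (hγ : 0 < γ) :
    ENNReal.ofReal γ ≤ meanFalseAlarm (M l) ρ S (Real.log γ + Real.log S.card) := by
  refine le_trans (ENNReal.ofReal_le_ofReal ?_) (le_meanFalseAlarm (M l) ρ S _ hS)
  have hcard : (0 : ℝ) < S.card := by exact_mod_cast hS.card_pos
  rw [Real.exp_add, Real.exp_log hγ, Real.exp_log hcard, ← mul_assoc, mul_div_cancel_right₀ _ hcard.ne']
  exact le_mul_of_one_le_left hγ.le (by exact_mod_cast hl)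

/-- A property that holds eventually for each `n` holds along some `N γ → ∞`. -/
theorem exists_tendsto_atTop_eventually {p : ℕ → ℝ → Prop} (hp : ∀ n, ∀ᶠ γ in atTop, p n γ) :
    ∃ N : ℝ → ℕ, Tendsto N atTop atTop ∧ ∀ᶠ γ in atTop, p (N γ) γ := by
  classical
  -- Diagonal choice: the largest `n ≤ ⌊γ⌋` whose property holds at `γ`.
  refine ⟨fun γ => Nat.findGreatest (p · γ) ⌊γ⌋₊, tendsto_atTop.mpr fun n => ?_, ?_⟩
  · filter_upwards [hp n, eventually_ge_atTop (n : ℝ)] with γ hγ hn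
    exact Nat.le_findGreatest (Nat.le_floor hn) hγ
  · filter_upwards [hp 0] with γ hγ
    exact Nat.findGreatest_spec (P := (p · γ)) (Nat.zero_le _) hγ

theorem achievesRate_of_le_meanLogRatio (hM : ∀ l, IsHayashiPVM ρ (M l)) (hS : S.Nonempty)
    {S' : Set (QState d)} {J : ℝ} (hJ : 0 < J)
    (hS' : ∀ τ ∈ S', SuppLE τ ρ ∧ ∃ σ ∈ S, SuppLE τ σ ∧ J ≤ meanLogRatio ρ σ τ) :
    AchievesRate M ρ S S' J := by
  refine ⟨fun ε hε => ?_, ?_⟩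
  · filter_upwards [eventually_familyDelay_le hM hJ hS' hε, eventually_ge_atTop S.card]
      with l hl hcard
    filter_upwards [hl] with h hh
    rw [← EReal.coe_div]
    refine ⟨hh, hh.trans ?_⟩
    rw [EReal.coe_div, EReal.coe_mul]
    refine EReal.div_le_div_right_of_nonneg (by exact_mod_cast hJ.le) ?_
    exact mul_le_mul_of_nonneg_right (le_log_meanFalseAlarm hS hcard h)
      (by exact_mod_cast (by positivity : (0 : ℝ) ≤ 1 + ε))
  · set p : ℕ → ℝ → Prop := fun n γ => ∃ l ≥ 1,
      familyDelay (M l) ρ S (Real.log γ + Real.log S.card) S'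
        ≤ ((Real.log γ * (1 + 1 / ((n : ℝ) + 1)) / J : ℝ) : EReal)
    have hp : ∀ n, ∀ᶠ γ in atTop, p n γ := fun n => by
      set ε : ℝ := 1 / ((n : ℝ) + 1) with hεdef
      have hε : 0 < ε := by positivity
      obtain ⟨l, hl, hl1⟩ := ((eventually_familyDelay_le hM hJ hS' (half_pos hε)).and
        (eventually_ge_atTop 1)).exists
      have htend : Tendsto (fun γ => Real.log γ + Real.log S.card) atTop atTop :=
        tendsto_atTop_add_const_right _ _ Real.tendsto_log_atTop
      -- Half of `ε` absorbs the additive `log |S|` in the threshold.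
      filter_upwards [htend.eventually hl, Real.tendsto_log_atTop.eventually_ge_atTop
        (Real.log S.card * (1 + ε / 2) / (ε / 2))] with γ hγ hlarge
      refine ⟨l, hl1, hγ.trans (EReal.coe_le_coe_iff.mpr ?_)⟩
      rw [div_le_iff₀ (by positivity)] at hlarge
      exact div_le_div_of_nonneg_right (by linarith) hJ.le
    obtain ⟨N, hN, hpN⟩ := exists_tendsto_atTop_eventually hp
    have hex : ∀ γ, ∃ l, p (N γ) γ → 1 ≤ l ∧
        familyDelay (M l) ρ S (Real.log γ + Real.log S.card) S'
          ≤ ((Real.log γ * (1 + 1 / ((N γ : ℝ) + 1)) / J : ℝ) : EReal) := fun γ => by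
      by_cases h : p (N γ) γ
      · obtain ⟨l, hl⟩ := h
        exact ⟨l, fun _ => hl⟩
      · exact ⟨0, fun h' => absurd h' h⟩
    choose L hL using hex
    refine ⟨L, fun γ => 1 / ((N γ : ℝ) + 1),
      tendsto_one_div_add_atTop_nhds_zero_nat.comp hN, ?_⟩
    filter_upwards [hpN, eventually_gt_atTop 0] with γ hγ hγ0
    refine ⟨ofReal_le_meanFalseAlarm hS (hL γ hγ).1 hγ0, ?_⟩
    rw [← EReal.coe_div]
    exact (hL γ hγ).2

/-- An infimum over no states is `⊤`; the delay is `0`, and division by `⊤` gives `0`. -/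
theorem achievesRate_empty (hS : S.Nonempty) : AchievesRate M ρ S ∅ ⊤ := by
  have h0 : ∀ l h, familyDelay (M l) ρ S h ∅ = 0 := fun l h => by simp [familyDelay]
  refine ⟨fun ε _ => .of_forall fun l => .of_forall fun h => ?_, fun _ => 1, fun _ => 0,
    tendsto_const_nhds, ?_⟩
  · simp [h0, EReal.div_top]
  · filter_upwards [eventually_gt_atTop 0] with γ hγ
    exact ⟨ofReal_le_meanFalseAlarm hS le_rfl hγ, by simp [h0, EReal.div_top]⟩

/-- An extended real lower bound of `max_σ (D(τ‖ρ) - D(τ‖σ))` on a non-empty family is achieved. -/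
theorem achievesRate_of_nonempty (hM : ∀ l, IsHayashiPVM ρ (M l)) (hS : S.Nonempty)
    {S' : Set (QState d)} (hne : S'.Nonempty) {I : EReal} (hI : 0 < I)
    (hS' : ∀ τ ∈ S', SuppLE τ ρ ∧ ∃ σ ∈ S, SuppLE τ σ ∧ I ≤ (meanLogRatio ρ σ τ : EReal)) :
    AchievesRate M ρ S S' I := by
  obtain ⟨τ, hτ⟩ := hne
  obtain ⟨-, σ, -, -, hle⟩ := hS' τ hτ
  -- One member of the family bounds `I` by a real number, so the rate is finite.
  have hcoe : ((I.toReal : ℝ) : EReal) = I :=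
    EReal.coe_toReal (hle.trans_lt (EReal.coe_lt_top _)).ne (EReal.bot_lt_zero.trans hI).ne'
  rw [← hcoe] at hI hS' ⊢
  refine achievesRate_of_le_meanLogRatio hM hS (by exact_mod_cast hI) fun τ hτ => ?_
  obtain ⟨hρ, σ, hσS, hσ, hle⟩ := hS' τ hτ
  exact ⟨hρ, σ, hσS, hσ, by exact_mod_cast hle⟩

end Rate

theorem mainTheorem4 {d : ℕ} (ρ : QState d) :
    (∀ l : ℕ, ∃ b : BlockPVM d l, IsHayashiPVM ρ b) ∧
    ∀ M : ∀ l, BlockPVM d l, (∀ l, IsHayashiPVM ρ (M l)) →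
    ∀ S : Finset (QState d), S.Nonempty → (∀ σ ∈ S, SuppLE σ ρ) →
      (∀ (l : ℕ) (h : ℝ),
        ENNReal.ofReal (l * Real.exp h / S.card) ≤ meanFalseAlarm (M l) ρ S h) ∧
      (∀ (l : ℕ) (h : ℝ) (σ : QState d),
        worstDelay (M l) ρ S h σ ≤
          l * (1 + ∫⁻ ω, (stopFrom (M l) ρ S h 0 ω : ℝ≥0∞) ∂pathLaw (M l) (fun _ => σ))) ∧
      (0 < ⨅ σ ∈ S, relEntropy σ ρ →
        AchievesRate M ρ S S (⨅ σ ∈ S, relEntropy σ ρ)) ∧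
      ∀ S' : Set (QState d), (∀ σ' ∈ S', SuppLE σ' ρ) →
        0 < ⨅ σ' ∈ S', ⨆ σ ∈ S, (relEntropy σ' ρ - relEntropy σ' σ) →
        AchievesRate M ρ S S' (⨅ σ' ∈ S', ⨆ σ ∈ S, (relEntropy σ' ρ - relEntropy σ' σ)) := by
  refine ⟨exists_isHayashiPVM ρ, fun M hM S hS hSρ =>
    ⟨fun l h => le_meanFalseAlarm (M l) ρ S h hS, fun l h σ => worstDelay_le (M l) ρ S h σ,
      fun hI => ?_, fun S' hS' hI => ?_⟩⟩
  -- The true state belongs to `S`, so it serves as its own comparison state.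
  · refine achievesRate_of_nonempty hM hS (by simpa using hS) hI fun τ hτ =>
      ⟨hSρ τ hτ, τ, hτ, SuppLE.refl τ, ?_⟩
    rw [← relEntropy_eq_meanLogRatio (hSρ τ hτ)]
    exact iInf₂_le τ hτ
  · rcases S'.eq_empty_or_nonempty with rfl | hne
    · simpa using achievesRate_empty hS
    · exact achievesRate_of_nonempty hM hS hne hI fun τ hτ =>
        ⟨hS' τ hτ, exists_le_meanLogRatio (hS' τ hτ) hI (iInf₂_le τ hτ)⟩
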